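/- All Hilbert spaces are finite-dimensional. Let $|\psi\rangle^{RAB}\in\mathcal H^R\otimes\mathcal H^A\otimes\mathcal H^B$ be a unit vector, with $\psi=|\psi\rangle\langle\psi|$ and reduced states denoted by superscripts. Let $$S_\psi^{A|R}=\left\{\frac{\operatorname{tr}_R[(\Lambda^R\otimes 1^A)\psi^{RA}]}{\operatorname{tr}[(\Lambda^R\otimes 1^A)\psi^{RA}]} : \Lambda^R\ge 0,\ \operatorname{tr}[(\Lambda^R\otimes 1^A)\psi^{RA}]\ne 0\right\},$$ a set of states whose joint support is $\operatorname{supp}(\psi^A)$. A *Koashi–Imoto decomposition* of $|\psi\rangle^{RAB}$ consists of orthogonal decompositions $$\operatorname{supp}(\psi^A)=\bigoplus_{j=0}^{J-1}\mathcal H^{a_j^L}\otimes\mathcal H^{a_j^R},\qquad \operatorname{supp}(\psi^B)=\bigoplus_{j=0}^{J-1}\mathcal H^{b_j^L}\otimes\mathcal H^{b_j^R},$$ a probability distribution $p$ on $\{0,\dots,J-1\}$ and unit vectors $|\omega_j\rangle^{a_j^Lb_j^L}$, $|\phi_j\rangle^{Ra_j^Rb_j^R}$ with $$|\psi\rangle^{RAB}=\bigoplus_{j=0}^{J-1}\sqrt{p(j)}\,|\omega_j\rangle^{a_j^Lb_j^L}\otimes|\phi_j\rangle^{Ra_j^Rb_j^R},$$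 such that, with $\omega_j=\operatorname{tr}_{b_j^L}|\omega_j\rangle\langle\omega_j|$: 1. every $\rho\in S_\psi^{A|R}$ has the form $\rho=\bigoplus_j p_\rho(j)\,\omega_j\otimes\phi_{\rho,j}$ with a probability distribution $p_\rho$ and density operators $\phi_{\rho,j}$ on $\mathcal H^{a_j^R}$; 2. for every completely positive trace-preserving map $\mathcal T$ on the operators on $\operatorname{supp}(\psi^A)$ that leaves every $\rho\in S_\psi^{A|R}$ invariant, every Stinespring isometry of $\mathcal T$ with environment $E$ has the form $\bigoplus_j U_j\otimes 1^{a_j^R}$, where $U_j:\mathcal H^{a_j^L}\to\mathcal H^{a_j^L}\otimes\mathcal H^{E}$ is an isometry with $\operatorname{tr}_{E}U_j\omega_jU_j^\dagger=\omega_j$. *Exact state merging of $|\psi\rangle^{RAB}$ in the non-catalytic setting* with initial resource $|\Phi_K^+\rangle=\frac1{\sqrt K}\sum_{l=0}^{K-1}|l\rangle^{\overline A}\otimes|l\rangle^{\overline B}$ ($K\ge1$ an integer) is achieved by an LOCC map $\mathcal M$ between $A$ (holding $\mathcal H^A,\mathcal H^{\overline A}$) and $B$ (holding $\mathcal H^B,\mathcal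 H^{\overline B}$, and at the end a copy $\mathcal H^{B'}$ of $\mathcal H^A$) if $(\mathrm{id}^R\otimes\mathcal M)(\psi^{RAB}\otimes\Phi_K^+)=\psi^{RB'B}$, up to a trivial product state $\Phi_1^+$; its entanglement cost is $\log_2K$. **Theorem.** Every $|\psi\rangle^{RAB}$ has a Koashi–Imoto decomposition. For every Koashi–Imoto decomposition of $|\psi\rangle^{RAB}$ there is an integer $K\ge 1$ with $$\log_2K\le\max_j\log_2\left\lceil\lambda_0^{a_j^L}\dim\mathcal H^{a_j^R}\right\rceil,$$ where $\lambda_0^{a_j^L}$ is the largest eigenvalue of $\omega_j$, such that exact state merging of $|\psi\rangle^{RAB}$ in the non-catalytic setting with initial resource $|\Phi_K^+\rangle$ is achieved by a (finite-round) LOCC map. -/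

import Mathlib

open scoped Matrix Kronecker ComplexOrder

noncomputable section

namespace QMerge

/-! ### Operators, states and maps of finite-dimensional systems

A system is given by a finite type indexing its computational basis; a composite system is indexed
by the product type. -/

/-- Operators on the system with computational basis `n`. -/
abbrev Op (n : Type) := Matrix n n ℂ

/-- A normalized ket. -/
def IsKet {n : Type} [Fintype n] (ψ : n → ℂ) : Prop := ∑ i, ‖ψ i‖ ^ 2 = 1

/-- The operator `|ψ⟩⟨ψ|`. -/
def proj {n : Type} (ψ : n → ℂ) : Op n := Matrix.vecMulVec ψ (star ψ)

/-- Density operators. -/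
def IsDensity {n : Type} [Fintype n] (ρ : Op n) : Prop := ρ.PosSemidef ∧ ρ.trace = 1

/-- Partial trace over the first tensor factor. -/
def traceFst {m n : Type} [Fintype m] (ρ : Op (m × n)) : Op n :=
  Matrix.of fun x y => ∑ i, ρ (i, x) (i, y)

/-- Partial trace over the second tensor factor. -/
def traceSnd {m n : Type} [Fintype n] (ρ : Op (m × n)) : Op m :=
  Matrix.of fun x y => ∑ i, ρ (x, i) (y, i)

/-- The support (range) of a Hermitian operator. -/
def supp {n : Type} [Fintype n] (ρ : Op n) : Submodule ℂ (n → ℂ) := LinearMap.range ρ.mulVecLin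

/-- The largest eigenvalue of a density operator. -/
def maxEigenvalue {n : Type} [Fintype n] [DecidableEq n] (ρ : Op n) : ℝ := sSup (spectrum ℝ ρ)

/-- The linear map `ρ ↦ M ρ M†`. -/
def conjMap {m n : Type} [Fintype n] (M : Matrix m n ℂ) : Op n →ₗ[ℂ] Op m where
  toFun ρ := M * ρ * Mᴴ
  map_add' ρ σ := by rw [Matrix.mul_add, Matrix.add_mul]
  map_smul' c ρ := by simp

/-- The completeness condition `∑ₖ Mₖ† Mₖ = 1` of a family of measurement operators. -/
def IsMeasurement {k : ℕ} {m n : Type} [Fintype m] [DecidableEq n]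
    (M : Fin k → Matrix m n ℂ) : Prop :=
  ∑ i, (M i)ᴴ * M i = 1

/-- The CPTP map `ρ ↦ ∑ₖ Mₖ ρ Mₖ†`.  Its Stinespring isometry is `∑ₖ Mₖ ⊗ |k⟩`. -/
def krausMap {k : ℕ} {m n : Type} [Fintype n] (M : Fin k → Matrix m n ℂ) : Op n →ₗ[ℂ] Op m :=
  ∑ i, conjMap (M i)

/-- The map `id ⊗ E`, where `id` acts on the operators of the system `r`. -/
def idTensor (r : Type) {m n : Type} (E : Op n →ₗ[ℂ] Op m) (ρ : Op (r × n)) : Op (r × m) :=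
  Matrix.of fun x y => E (Matrix.of fun i j => ρ (x.1, i) (y.1, j)) x.2 y.2

/-! ### Local operations and classical communication -/

/-- Finite-round LOCC maps from the bipartite system `a ⊗ b` to `a' ⊗ b'`; the first factor is held
by Alice, the second by Bob.  In each round one party performs a measurement (possibly changing
that party's system) and broadcasts the outcome `i`, on which the remaining protocol `F i` depends.
At the end both parties measure locally, and all outcomes are discarded. -/
inductive IsFiniteRoundLOCC {a' b' : Type} [Fintype a'] [Fintype b'] :
    ∀ {a b : Type} [Fintype a] [DecidableEq a] [Fintype b] [DecidableEq b],
      (Op (a × b) →ₗ[ℂ] Op (a' × b')) → Prop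
  | local {a b : Type} [Fintype a] [DecidableEq a] [Fintype b] [DecidableEq b] {k l : ℕ}
      (M : Fin k → Matrix a' a ℂ) (N : Fin l → Matrix b' b ℂ)
      (hM : IsMeasurement M) (hN : IsMeasurement N) :
      IsFiniteRoundLOCC (∑ i, ∑ j, conjMap (M i ⊗ₖ N j))
  | alice {a b c : Type} [Fintype a] [DecidableEq a] [Fintype b] [DecidableEq b]
      [Fintype c] [DecidableEq c] {k : ℕ} (M : Fin k → Matrix c a ℂ) (hM : IsMeasurement M)
      (F : Fin k → (Op (c × b) →ₗ[ℂ] Op (a' × b'))) (hF : ∀ i, IsFiniteRoundLOCC (F i)) :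
      IsFiniteRoundLOCC (∑ i, F i ∘ₗ conjMap (M i ⊗ₖ (1 : Op b)))
  | bob {a b c : Type} [Fintype a] [DecidableEq a] [Fintype b] [DecidableEq b]
      [Fintype c] [DecidableEq c] {k : ℕ} (M : Fin k → Matrix c b ℂ) (hM : IsMeasurement M)
      (F : Fin k → (Op (a × c) →ₗ[ℂ] Op (a' × b'))) (hF : ∀ i, IsFiniteRoundLOCC (F i)) :
      IsFiniteRoundLOCC (∑ i, F i ∘ₗ conjMap ((1 : Op a) ⊗ₖ M i))

/-! ### The Koashi–Imoto decomposition -/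

/-- The computational basis of `⨁ⱼ ℂ^(dL j) ⊗ ℂ^(dR j)`. -/
abbrev Blocks {J : ℕ} (dL dR : Fin J → ℕ) : Type := Σ j : Fin J, Fin (dL j) × Fin (dR j)

/-- The isometry `V` from `⨁ⱼ ℂ^(dL j) ⊗ ℂ^(dR j)` into the system `A`, together with the density
operators `ω j` on `ℂ^(dL j)`, is the Koashi–Imoto decomposition of the set `S` of states of `A`:
it decomposes the smallest subspace supporting all states of `S`, and
* every state of `S` is `⨁ⱼ p j • (ω j ⊗ φ j)`, where only `p` and `φ` depend on the state;
* every CPTP map on that subspace leaving all states of `S` invariant acts, in each block, on the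
  left factor only and leaves `ω j` invariant: all its Kraus operators (the components of its
  Stinespring isometry) are of the form `⨁ⱼ N j ⊗ 1`. -/
structure IsKoashiImoto {A : Type} [Fintype A] (S : Set (Op A)) {J : ℕ} {dL dR : Fin J → ℕ}
    (V : Matrix A (Blocks dL dR) ℂ) (ω : ∀ j, Op (Fin (dL j))) : Prop where
  isometry : Vᴴ * V = 1
  range_eq : LinearMap.range V.mulVecLin = ⨆ ρ ∈ S, supp ρ
  density : ∀ j, IsDensity (ω j)
  decompose : ∀ ρ ∈ S, ∃ (p : Fin J → ℝ) (φ : ∀ j, Op (Fin (dR j))),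
    (∀ j, 0 ≤ p j) ∧ ∑ j, p j = 1 ∧ (∀ j, IsDensity (φ j)) ∧
      ρ = V * Matrix.blockDiagonal' (fun j => (p j : ℂ) • (ω j ⊗ₖ φ j)) * Vᴴ
  maximal : ∀ (k : ℕ) (M : Fin k → Op (Blocks dL dR)), IsMeasurement M →
    (∀ ρ ∈ S, krausMap M (Vᴴ * ρ * V) = Vᴴ * ρ * V) →
    ∃ N : ∀ j, Fin k → Op (Fin (dL j)),
      (∀ j, IsMeasurement (N j)) ∧ (∀ j, krausMap (N j) (ω j) = ω j) ∧
        ∀ i, M i = Matrix.blockDiagonal' (fun j => N j i ⊗ₖ (1 : Op (Fin (dR j))))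

section Tripartite

variable {R A B : Type} [Fintype R] [Fintype A] [Fintype B]

/-- The reduced state of `R ⊗ A`. -/
def stateRA (ψ : R × A × B → ℂ) : Op (R × A) :=
  traceSnd ((proj ψ).submatrix (Equiv.prodAssoc R A B) (Equiv.prodAssoc R A B))

/-- The reduced state of `B`. -/
def stateB (ψ : R × A × B → ℂ) : Op B := traceFst (traceFst (proj ψ))

/-- The operator `tr_R [(Λ ⊗ 1) ψ^{RA}]`. -/
def steer [DecidableEq A] (ψ : R × A × B → ℂ) (Λ : Op R) : Op A :=
  traceFst ((Λ ⊗ₖ (1 : Op A)) * stateRA ψ)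

/-- The states of `A` that can be steered by a post-selected measurement on `R`. -/
def steeredStates [DecidableEq A] (ψ : R × A × B → ℂ) : Set (Op A) :=
  {ρ | ∃ Λ : Op R, Λ.PosSemidef ∧ (steer ψ Λ).trace ≠ 0 ∧
    ρ = (steer ψ Λ).trace⁻¹ • steer ψ Λ}

/-- A Koashi–Imoto decomposition of a tripartite pure state `ψ`: the Koashi–Imoto decomposition of
the set of its steered states, with `supp ψ^B = ⨁ⱼ ℂ^(bL j) ⊗ ℂ^(bR j)` (through `W`) and
`ψ = ⨁ⱼ √(p j) • ω j ⊗ φ j`, where `ω j` is a ket of `a_j^L b_j^L` and `φ j` of `R a_j^R b_j^R`. -/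
structure KoashiImoto [DecidableEq A] (ψ : R × A × B → ℂ) where
  J : ℕ
  (aL aR bL bR : Fin J → ℕ)
  V : Matrix A (Blocks aL aR) ℂ
  W : Matrix B (Blocks bL bR) ℂ
  p : Fin J → ℝ
  ω : ∀ j, Fin (aL j) × Fin (bL j) → ℂ
  φ : ∀ j, R × Fin (aR j) × Fin (bR j) → ℂ
  isKoashiImoto : IsKoashiImoto (steeredStates ψ) V (fun j => traceSnd (proj (ω j)))
  isometry_W : Wᴴ * W = 1
  range_W : LinearMap.range W.mulVecLin = supp (stateB ψ)
  p_nonneg : ∀ j, 0 ≤ p j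
  p_sum : ∑ j, p j = 1
  isKet_ω : ∀ j, IsKet (ω j)
  isKet_φ : ∀ j, IsKet (φ j)
  decompose : ∀ r a b, ψ (r, a, b) =
    ∑ j, (Real.sqrt (p j) : ℂ) * ∑ s : Fin (aL j), ∑ t : Fin (aR j), ∑ u : Fin (bL j),
      ∑ v : Fin (bR j), V a ⟨j, s, t⟩ * W b ⟨j, u, v⟩ * ω j (s, u) * φ j (r, t, v)

/-- `λ₀`: the largest eigenvalue of the reduced state of `ω j` on `a_j^L`. -/
def KoashiImoto.lambda₀ [DecidableEq A] {ψ : R × A × B → ℂ} (D : KoashiImoto ψ) (j : Fin D.J) : ℝ :=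
  maxEigenvalue (traceSnd (proj (D.ω j)))

end Tripartite

/-! ### Exact state merging -/

/-- The maximally entangled state of Schmidt rank `K`. -/
def maxEnt (K : ℕ) : Fin K × Fin K → ℂ := fun x => if x.1 = x.2 then ((Real.sqrt K)⁻¹ : ℝ) else 0

/-- `ψ^{RAB} ⊗ Φ_K`: Alice holds `A` and one half of `Φ_K`, Bob holds `B` and the other half. -/
def mergeInput {R A B : Type} (ψ : R × A × B → ℂ) (K : ℕ) :
    R × ((A × Fin K) × (B × Fin K)) → ℂ :=
  fun ⟨r, (a, k), (b, l)⟩ => ψ (r, a, b) * maxEnt K (k, l)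

/-- `ψ^{RB'B} ⊗ Φ_L`: Alice holds one half of `Φ_L`, Bob holds `B'` (a copy of `A`), `B` and the
other half. -/
def mergeOutput {R A B : Type} (ψ : R × A × B → ℂ) (L : ℕ) :
    R × (Fin L × (A × B × Fin L)) → ℂ :=
  fun ⟨r, k, (a, b, l)⟩ => ψ (r, a, b) * maxEnt L (k, l)

/-- Exact state merging of `ψ` from `Φ_K` to `Φ_L` is achieved by some (finite-round) LOCC map.
The non-catalytic setting is `L = 1`. -/
def ExactMerging {R A B : Type} [Fintype A] [DecidableEq A] [Fintype B] [DecidableEq B]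
    (ψ : R × A × B → ℂ) (K L : ℕ) : Prop :=
  ∃ E : Op ((A × Fin K) × (B × Fin K)) →ₗ[ℂ] Op (Fin L × (A × B × Fin L)),
    IsFiniteRoundLOCC E ∧ idTensor R E (proj (mergeInput ψ K)) = proj (mergeOutput ψ L)

end QMerge

end

noncomputable section

namespace QMerge

/-! Existence of the decomposition. On the support of `ψ^A` the steered states contain a faithful
one, `ρ₀ = ψ^A`. For a channel with a faithful invariant state, the fixed points of its dual are
exactly the operators commuting with all Kraus operators and their adjoints
(`krausCommutant_eq_ker`). A dimension count then gives the fixed points of the channel itself as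
`ρ₀ · C = C · ρ₀`, where `C` is this commutant (`exists_mul_of_krausMap_eq`). Let `𝒜` be the
intersection of these commutants over all channels fixing every steered state. Then `ρ₀⁻¹ρ ∈ 𝒜` for
every steered `ρ`, and conjugation by `ρ₀` preserves `𝒜`. In the isotypic decomposition
(`exists_isotypicDecomposition`) `𝒜` acts as `⨁ 1 ⊗ π_j`. By Schur's lemma, Kraus operators, which
commute with `𝒜`, are `⨁ N_j ⊗ 1`, and `ρ₀`, which normalizes it, is `⨁ ω_j ⊗ h_j`. Hence `ρ =
ρ₀(ρ₀⁻¹ρ)` is `⨁ ω_j ⊗ h_j π_j(ρ₀⁻¹ρ)`. By linearity the same form holds for the operators `ψ_r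
ψ_{r'}†` built from the slices of `ψ`, and uniqueness of purifications transports the block
structure to `B` (`exists_coisometry_of_gram_eq`, `nonempty_koashiImoto`).

Merging. It suffices that Alice has a rank-one measurement on `A` and her half of `Φ_K` whose
outcomes tell nothing about `R`: Bob then holds a purification of `ψ^R` and restores `ψ` locally
(`exactMerging_of_measurement`). In the eigenbasis of each `ω_j`, the distribution `l_{j,s} / K` on
pairs `(s, k)` is bounded by `1 / dim a_j^R` as soon as `λ₀ dim a_j^R ≤ K`. By Birkhoff's theorem it
is then the common marginal of a random injection `g_j` from the basis of `a_j^R` into these pairs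
(`exists_random_injection`). The measurement vectors are superpositions of the `|g_j(t)⟩|t⟩` over
all `j` and `t`, with random signs (`exists_measurement_coefficients`). Averaging over signs and
injections gives completeness. Injectivity makes Bob's side of `ω_j ⊗ Φ_K` record `t` in orthogonal
states, so coherence on `a_j^R` passes to Bob intact, and the blocks stay in superposition. Thus a
single `K`, the largest of the ceilings, serves all blocks at once. -/

/-! ### Spectral factorizations -/

lemma exists_unitary_diagonalization {n : Type} [Fintype n] [DecidableEq n] {H : Matrix n n ℂ}
    (hH : H.IsHermitian) : ∃ U : Matrix n n ℂ, Uᴴ * U = 1 ∧ U * Uᴴ = 1 ∧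
      H = U * Matrix.diagonal (fun i => (hH.eigenvalues i : ℂ)) * Uᴴ :=
  ⟨hH.eigenvectorUnitary, Unitary.coe_star_mul_self _, Unitary.coe_mul_star_self _, by
    simpa [Unitary.conjStarAlgAut_apply, Matrix.star_eq_conjTranspose] using! hH.spectral_theorem⟩

/-- The spectral decomposition of a positive semidefinite matrix, without its kernel. -/
lemma exists_compact_spectral {n : Type} [Fintype n] [DecidableEq n] {ρ : Matrix n n ℂ}
    (hρ : ρ.PosSemidef) : ∃ (m : ℕ) (V : Matrix n (Fin m) ℂ) (d : Fin m → ℝ), (∀ i, 0 < d i) ∧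
      Vᴴ * V = 1 ∧ ρ = V * Matrix.diagonal (fun i => (d i : ℂ)) * Vᴴ := by
  obtain ⟨U, hU, -, hd⟩ := exists_unitary_diagonalization hρ.isHermitian
  have hl := hρ.eigenvalues_nonneg
  generalize hρ.isHermitian.eigenvalues = l at hd hl
  let e := (Fintype.equivFin {i // 0 < l i}).symm
  refine ⟨_, U.submatrix id (fun i => (e i).1), fun i => l (e i), fun i => (e i).2, ?_, ?_⟩
  · rw [Matrix.conjTranspose_submatrix, ← Matrix.submatrix_mul _ _ _ _ _ Function.bijective_id, hU]
    ext i j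
    simp [Matrix.one_apply, Subtype.coe_inj]
  · ext x y
    rw [hd, Matrix.mul_apply, Matrix.mul_apply]
    simp only [Matrix.mul_diagonal, Matrix.submatrix_apply,
      Matrix.conjTranspose_apply, id]
    rw [e.sum_comp (fun i => U x i.1 * (l i.1 : ℂ) * star (U y i.1)),
      ← Finset.sum_subtype (Finset.univ.filter fun i => 0 < l i) (by simp)
        (fun i => U x i * (l i : ℂ) * star (U y i)), Finset.sum_filter_of_ne]
    intro i _ h
    refine lt_of_le_of_ne (hl i) fun h0 => h ?_
    simp [← h0]

/-- A factorization of a positive semidefinite matrix into factors of full column rank. -/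
lemma exists_mul_conjTranspose_eq {n : Type} [Fintype n] [DecidableEq n] {ρ : Matrix n n ℂ}
    (hρ : ρ.PosSemidef) : ∃ (m : ℕ) (X : Matrix n (Fin m) ℂ) (d : Fin m → ℝ), (∀ i, 0 < d i) ∧
      Xᴴ * X = Matrix.diagonal (fun i => (d i : ℂ)) ∧ X * Xᴴ = ρ := by
  obtain ⟨m, V, d, hd, hV, rfl⟩ := exists_compact_spectral hρ
  have hs : ∀ i, ((√(d i) : ℝ) : ℂ) * ((√(d i) : ℝ) : ℂ) = d i := fun i => by
    rw [← Complex.ofReal_mul, Real.mul_self_sqrt (hd i).le]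
  refine ⟨m, V * Matrix.diagonal (fun i => ((√(d i) : ℝ) : ℂ)), d, hd, ?_, ?_⟩
  · rw [Matrix.conjTranspose_mul, Matrix.mul_assoc, ← Matrix.mul_assoc Vᴴ, hV, Matrix.one_mul,
      Matrix.diagonal_conjTranspose, Matrix.diagonal_mul_diagonal]
    simp [hs]
  · rw [Matrix.conjTranspose_mul, Matrix.mul_assoc, ← Matrix.mul_assoc (Matrix.diagonal _),
      Matrix.diagonal_conjTranspose, Matrix.diagonal_mul_diagonal]
    simp [hs, Matrix.mul_assoc]

lemma eq_zero_of_mul_posDef {m n : Type} [Fintype m] [Fintype n] [DecidableEq n]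
    {ρ : Matrix n n ℂ} (hρ : ρ.PosDef) {C : Matrix m n ℂ} (h : (C * ρ * Cᴴ).trace = 0) : C = 0 := by
  obtain ⟨_, B, -, -, -, hB⟩ := exists_mul_conjTranspose_eq hρ.posSemidef
  have h1 : C * B = 0 := by
    rw [← Matrix.trace_mul_conjTranspose_self_eq_zero_iff, ← h, ← hB]
    simp [Matrix.mul_assoc]
  have h2 : C * ρ = 0 := by rw [← hB, ← Matrix.mul_assoc, h1, Matrix.zero_mul]
  have h3 : ρ * ρ⁻¹ = 1 := Matrix.mul_nonsing_inv _ ((Matrix.isUnit_iff_isUnit_det _).mp hρ.isUnit)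
  rw [← Matrix.mul_one C, ← h3, ← Matrix.mul_assoc, h2, Matrix.zero_mul]

/-! ### Fixed points of channels with a faithful invariant state -/

/-- The Heisenberg-picture dual `X ↦ ∑ₖ Mₖ† X Mₖ` of `krausMap M`. -/
def krausDual {k : ℕ} {m n : Type} [Fintype m] (M : Fin k → Matrix m n ℂ) : Op m →ₗ[ℂ] Op n where
  toFun X := ∑ i, (M i)ᴴ * X * M i
  map_add' X Y := by simp [Matrix.mul_add, Matrix.add_mul, Finset.sum_add_distrib]
  map_smul' c X := by simp [Finset.smul_sum]

lemma krausMap_apply {k : ℕ} {m n : Type} [Fintype n] (M : Fin k → Matrix m n ℂ) (ρ : Op n) :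
    krausMap M ρ = ∑ i, M i * ρ * (M i)ᴴ := by
  simp [krausMap, conjMap, LinearMap.sum_apply]

lemma krausDual_apply {k : ℕ} {m n : Type} [Fintype m] (M : Fin k → Matrix m n ℂ) (X : Op m) :
    krausDual M X = ∑ i, (M i)ᴴ * X * M i := rfl

lemma trace_krausMap_mul {k : ℕ} {m n : Type} [Fintype m] [Fintype n] (M : Fin k → Matrix m n ℂ)
    (ρ : Op n) (X : Op m) : (krausMap M ρ * X).trace = (ρ * krausDual M X).trace := by
  simp only [krausMap_apply, krausDual_apply, Matrix.sum_mul, Matrix.mul_sum, Matrix.trace_sum]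
  refine Finset.sum_congr rfl fun i _ => ?_
  rw [Matrix.mul_assoc, Matrix.mul_assoc, Matrix.trace_mul_comm]
  simp [Matrix.mul_assoc]

section FixedPoints

variable {k : ℕ} {n : Type} [Fintype n] [DecidableEq n] {M : Fin k → Matrix n n ℂ} {ρ : Op n}

/-- The fixed points of the dual of a channel with a faithful invariant state commute with the
Kraus operators. -/
lemma commute_kraus_of_krausDual_eq (hM : IsMeasurement M) (hρ : ρ.PosDef)
    (hfix : krausMap M ρ = ρ) {X : Op n} (hX : krausDual M X = X) (i : Fin k) :
    M i * X = X * M i := by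
  have hX' : ∑ i, (M i)ᴴ * Xᴴ * M i = Xᴴ := by
    conv_rhs => rw [← hX, krausDual_apply]
    simp [Matrix.conjTranspose_sum, Matrix.mul_assoc]
  rw [krausDual_apply] at hX
  -- The squares of the commutators add up to the defect `E*(X†X) - X†X` of the dual map; its
  -- expectation in the invariant state `ρ` is zero, and faithfulness kills each commutator.
  have key : ∑ i, (M i * X - X * M i)ᴴ * (M i * X - X * M i) =
      krausDual M (Xᴴ * X) - Xᴴ * X := by
    have e : ∀ i, (M i * X - X * M i)ᴴ * (M i * X - X * M i) =
        (M i)ᴴ * (Xᴴ * X) * M i - ((M i)ᴴ * Xᴴ * M i) * X - Xᴴ * ((M i)ᴴ * X * M i)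
          + Xᴴ * ((M i)ᴴ * M i) * X := by
      intro i
      simp only [Matrix.conjTranspose_sub, Matrix.conjTranspose_mul]
      noncomm_ring
    simp only [e, Finset.sum_add_distrib, Finset.sum_sub_distrib, ← Matrix.mul_sum,
      ← Matrix.sum_mul, hX, hX', krausDual_apply]
    rw [show ∑ i, (M i)ᴴ * M i = 1 from hM]
    simp
  have h0 : ∑ i, ((M i * X - X * M i) * ρ * (M i * X - X * M i)ᴴ).trace = 0 := by
    have : ∀ i, ((M i * X - X * M i) * ρ * (M i * X - X * M i)ᴴ).trace =
        (ρ * ((M i * X - X * M i)ᴴ * (M i * X - X * M i))).trace := fun i => by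
      rw [Matrix.mul_assoc, Matrix.trace_mul_comm, Matrix.mul_assoc]
    simp only [this]
    rw [← Matrix.trace_sum, ← Matrix.mul_sum, key, Matrix.mul_sub, Matrix.trace_sub,
      ← trace_krausMap_mul, hfix, sub_self]
  have h1 := (Finset.sum_eq_zero_iff_of_nonneg fun i _ =>
    (hρ.posSemidef.mul_mul_conjTranspose_same (M i * X - X * M i)).trace_nonneg).mp h0 i
      (Finset.mem_univ i)
  exact sub_eq_zero.mp (eq_zero_of_mul_posDef hρ h1)

/-- The operators commuting with all Kraus operators and their adjoints. -/
def krausCommutant (M : Fin k → Matrix n n ℂ) : Submodule ℂ (Op n) where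
  carrier := {X | ∀ i, M i * X = X * M i ∧ (M i)ᴴ * X = X * (M i)ᴴ}
  zero_mem' := by simp
  add_mem' := fun hX hY i => by simp [Matrix.mul_add, Matrix.add_mul, hX i, hY i]
  smul_mem' := fun c X hX i => by simp [hX i]

lemma mem_krausCommutant {X : Op n} :
    X ∈ krausCommutant M ↔ ∀ i, M i * X = X * M i ∧ (M i)ᴴ * X = X * (M i)ᴴ := Iff.rfl

/-- The fixed points of the dual are closed under adjoints, so applying
`commute_kraus_of_krausDual_eq` to `X` and to `Xᴴ` gives both commutation relations. The converse is
completeness of the Kraus family. -/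
lemma krausCommutant_eq_ker (hM : IsMeasurement M) (hρ : ρ.PosDef) (hfix : krausMap M ρ = ρ) :
    krausCommutant M = LinearMap.ker (krausDual M - 1) := by
  ext X
  rw [mem_krausCommutant, LinearMap.mem_ker, LinearMap.sub_apply, sub_eq_zero, Module.End.one_apply]
  refine ⟨fun h => ?_, fun h i => ⟨commute_kraus_of_krausDual_eq hM hρ hfix h i, ?_⟩⟩
  · rw [krausDual_apply]
    simp only [Matrix.mul_assoc, ← (h _).1]
    simp only [← Matrix.mul_assoc, ← Matrix.sum_mul]
    rw [show ∑ i, (M i)ᴴ * M i = 1 from hM, Matrix.one_mul]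
  · have hX' : krausDual M Xᴴ = Xᴴ := by
      conv_rhs => rw [← h, krausDual_apply]
      simp [krausDual_apply, Matrix.conjTranspose_sum, Matrix.mul_assoc]
    have := congrArg Matrix.conjTranspose (commute_kraus_of_krausDual_eq hM hρ hfix hX' i)
    simpa using this.symm

/-- The trace pairing identifies `krausDual M - 1` with the transpose of `krausMap M - 1`, and
transposes have equal rank. -/
lemma finrank_ker_krausMap_sub_one (M : Fin k → Matrix n n ℂ) :
    Module.finrank ℂ (LinearMap.ker (krausMap M - 1 : Op n →ₗ[ℂ] Op n)) =
      Module.finrank ℂ (LinearMap.ker (krausDual M - 1 : Op n →ₗ[ℂ] Op n)) := by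
  let b : Op n →ₗ[ℂ] Module.Dual ℂ (Op n) :=
    LinearMap.mk₂ ℂ (fun X Y : Op n => (Y * X).trace) (by simp [Matrix.mul_add]) (by simp)
      (by simp [Matrix.add_mul]) (by simp)
  have hb : Function.Injective b := by
    rw [injective_iff_map_eq_zero]
    intro X hX
    rw [Matrix.ext_iff_trace_mul_left]
    intro Y
    have := LinearMap.congr_fun hX Y
    simpa [b] using this
  let e : Op n ≃ₗ[ℂ] Module.Dual ℂ (Op n) :=
    LinearEquiv.ofInjectiveOfFinrankEq b hb (Subspace.dual_finrank_eq (K := ℂ) (V := Op n)).symm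
  have he : ∀ X Y : Op n, e X Y = (Y * X).trace := fun X Y => rfl
  have h1 : (krausMap M - 1 : Op n →ₗ[ℂ] Op n).dualMap ∘ₗ e.toLinearMap =
      e.toLinearMap ∘ₗ (krausDual M - 1) := by
    refine LinearMap.ext fun X => LinearMap.ext fun Y => ?_
    simp only [LinearMap.comp_apply, LinearEquiv.coe_coe, LinearMap.dualMap_apply, he,
      LinearMap.sub_apply, Module.End.one_apply, Matrix.sub_mul, Matrix.mul_sub, Matrix.trace_sub,
      trace_krausMap_mul]
  have h2 : Module.finrank ℂ (LinearMap.range (krausMap M - 1 : Op n →ₗ[ℂ] Op n)) =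
      Module.finrank ℂ (LinearMap.range (krausDual M - 1 : Op n →ₗ[ℂ] Op n)) := by
    rw [← LinearMap.finrank_range_dualMap_eq_finrank_range (krausMap M - 1 : Op n →ₗ[ℂ] Op n),
      ← LinearMap.range_comp_of_range_eq_top _ e.range, h1, LinearMap.range_comp]
    exact (LinearEquiv.finrank_map_eq e _)
  have h3 := LinearMap.finrank_range_add_finrank_ker (krausMap M - 1 : Op n →ₗ[ℂ] Op n)
  have h4 := LinearMap.finrank_range_add_finrank_ker (krausDual M - 1 : Op n →ₗ[ℂ] Op n)
  omega

omit [DecidableEq n] in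
lemma exists_mul_eq_of_finrank {F G : Submodule ℂ (Op n)} {f : Op n →ₗ[ℂ] Op n}
    (hf : Function.Injective f) (hFG : ∀ X ∈ F, f X ∈ G)
    (hr : Module.finrank ℂ G = Module.finrank ℂ F) {Y : Op n} (hY : Y ∈ G) : ∃ X ∈ F, f X = Y := by
  have h : F.map f = G := by
    refine Submodule.eq_of_le_of_finrank_eq (Submodule.map_le_iff_le_comap.mpr hFG) ?_
    rw [hr, (Submodule.equivMapOfInjective f hf F).finrank_eq]
  rw [← h] at hY
  simpa using hY

lemma krausMap_mul_of_mem_krausCommutant (hfix : krausMap M ρ = ρ) {X : Op n}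
    (hX : X ∈ krausCommutant M) : krausMap M (ρ * X) = ρ * X := by
  rw [krausMap_apply] at hfix ⊢
  have h : ∀ i, M i * (ρ * X) * (M i)ᴴ = M i * ρ * (M i)ᴴ * X := fun i => by
    rw [Matrix.mul_assoc, Matrix.mul_assoc, ← (hX i).2]
    simp [Matrix.mul_assoc]
  simp only [h, ← Matrix.sum_mul, hfix]

/-- Multiplying the commutant by `ρ` on either side lands injectively in the fixed points, and both
spaces have the same dimension. That both sides work is what later makes conjugation by `ρ` preserve
the commutants. -/
lemma exists_mul_of_krausMap_eq (hM : IsMeasurement M) (hρ : ρ.PosDef) (hfix : krausMap M ρ = ρ)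
    {Y : Op n} (hY : krausMap M Y = Y) :
    (∃ X ∈ krausCommutant M, ρ * X = Y) ∧ ∃ X ∈ krausCommutant M, X * ρ = Y := by
  have hd : IsUnit ρ.det := (Matrix.isUnit_iff_isUnit_det _).mp hρ.isUnit
  have hr : Module.finrank ℂ (LinearMap.ker (krausMap M - 1 : Op n →ₗ[ℂ] Op n)) =
      Module.finrank ℂ (krausCommutant M) := by
    rw [krausCommutant_eq_ker hM hρ hfix, finrank_ker_krausMap_sub_one]
  have hmem : Y ∈ LinearMap.ker (krausMap M - 1 : Op n →ₗ[ℂ] Op n) := by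
    simp [LinearMap.mem_ker, hY]
  constructor
  · refine exists_mul_eq_of_finrank (f := LinearMap.mulLeft ℂ ρ) (fun X X' h => ?_)
      (fun X hX => ?_) hr hmem
    · have := congrArg (ρ⁻¹ * ·) h
      simpa [← Matrix.mul_assoc, Matrix.nonsing_inv_mul _ hd] using this
    · simp only [LinearMap.mem_ker, LinearMap.sub_apply, Module.End.one_apply, sub_eq_zero,
        LinearMap.mulLeft_apply]
      exact krausMap_mul_of_mem_krausCommutant hfix hX
  · refine exists_mul_eq_of_finrank (f := LinearMap.mulRight ℂ ρ) (fun X X' h => ?_)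
      (fun X hX => ?_) hr hmem
    · have := congrArg (· * ρ⁻¹) h
      simpa [Matrix.mul_assoc, Matrix.mul_nonsing_inv _ hd] using this
    · simp only [LinearMap.mem_ker, LinearMap.sub_apply, Module.End.one_apply, sub_eq_zero,
        krausMap_apply, LinearMap.mulRight_apply]
      rw [krausMap_apply] at hfix
      have h : ∀ i, M i * (X * ρ) * (M i)ᴴ = X * (M i * ρ * (M i)ᴴ) := fun i => by
        rw [← Matrix.mul_assoc, (hX i).1]
        simp [Matrix.mul_assoc]
      simp only [h, ← Matrix.mul_sum, hfix]

end FixedPoints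

/-! ### Decomposition into irreducible invariant subspaces -/

section Irreducible

variable {n : Type} [Fintype n] [DecidableEq n]

/-- A family of isometries onto irreducible invariant subspaces of a self-adjoint set `𝒜` of
operators, decomposing the whole space orthogonally. -/
structure IsIrreducibleDecomposition (𝒜 : Set (Op n)) {I : Type} [Fintype I] (d : I → ℕ)
    (u : ∀ i, Matrix n (Fin (d i)) ℂ) : Prop where
  pos : ∀ i, 0 < d i
  isometry : ∀ i, (u i)ᴴ * u i = 1
  orthogonal : ∀ i k, i ≠ k → (u i)ᴴ * u k = 0
  complete : ∑ i, u i * (u i)ᴴ = 1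
  invariant : ∀ a ∈ 𝒜, ∀ i, a * u i = u i * ((u i)ᴴ * a * u i)
  irreducible : ∀ i, ∀ C : Op (Fin (d i)),
    (∀ a ∈ 𝒜, C * ((u i)ᴴ * a * u i) = ((u i)ᴴ * a * u i) * C) → ∃ c : ℂ, C = c • 1

/-- The Hermitian and anti-Hermitian parts of `C` also commute with the self-adjoint set `𝒜`; if
both were scalar, so would be `C`. -/
lemma exists_isHermitian_commute {𝒜 : Set (Op n)} (h𝒜 : ∀ a ∈ 𝒜, aᴴ ∈ 𝒜) {C : Op n}
    (hC : ∀ a ∈ 𝒜, C * a = a * C) (hn : ¬ ∃ c : ℂ, C = c • 1) :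
    ∃ H : Op n, H.IsHermitian ∧ (∀ a ∈ 𝒜, H * a = a * H) ∧ ¬ ∃ c : ℂ, H = c • 1 := by
  have hC' : ∀ a ∈ 𝒜, Cᴴ * a = a * Cᴴ := fun a ha => by
    simpa using (congrArg Matrix.conjTranspose (hC _ (h𝒜 a ha))).symm
  by_contra! hcon
  obtain ⟨c₁, h₁⟩ := hcon (C + Cᴴ) (by simp [Matrix.IsHermitian, add_comm])
    fun a ha => by rw [Matrix.add_mul, Matrix.mul_add, hC a ha, hC' a ha]
  obtain ⟨c₂, h₂⟩ := hcon (Complex.I • (C - Cᴴ)) (by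
      simp only [Matrix.IsHermitian, Matrix.conjTranspose_smul, Matrix.conjTranspose_sub,
        Matrix.conjTranspose_conjTranspose, RCLike.star_def, Complex.conj_I]
      module)
    fun a ha => by
      rw [Matrix.smul_mul, Matrix.mul_smul, Matrix.sub_mul, Matrix.mul_sub, hC a ha, hC' a ha]
  refine hn ⟨(c₁ - Complex.I * c₂) / 2, ?_⟩
  have : (2 : ℂ) • C = (C + Cᴴ) - Complex.I • (Complex.I • (C - Cᴴ)) := by
    rw [smul_smul, Complex.I_mul_I, two_smul]
    module
  rw [h₁, h₂, smul_smul, ← sub_smul] at this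
  rw [div_eq_inv_mul, mul_smul, ← this, smul_smul]
  simp

/-- A self-adjoint set of operators with a nontrivial commutant has a nontrivial orthogonal pair of
invariant subspaces. -/
lemma exists_invariant_splitting {𝒜 : Set (Op n)} {H : Op n} (hH : H.IsHermitian)
    (hcomm : ∀ a ∈ 𝒜, H * a = a * H) (hn : ¬ ∃ c : ℂ, H = c • 1) :
    ∃ (p : n → Prop) (_ : DecidablePred p) (u₁ : Matrix n {i // p i} ℂ)
      (u₂ : Matrix n {i // ¬ p i} ℂ), (∃ i, p i) ∧ (∃ i, ¬ p i) ∧ u₁ᴴ * u₁ = 1 ∧ u₂ᴴ * u₂ = 1 ∧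
        u₁ᴴ * u₂ = 0 ∧ u₁ * u₁ᴴ + u₂ * u₂ᴴ = 1 ∧
        ∀ a ∈ 𝒜, u₁ᴴ * a * u₂ = 0 ∧ u₂ᴴ * a * u₁ = 0 := by
  obtain ⟨U, hU, hU', hd⟩ := exists_unitary_diagonalization hH
  generalize hH.eigenvalues = l at hd
  have hne : ∃ i k, l i ≠ l k := by
    by_contra! hcon
    refine hn ?_
    rcases isEmpty_or_nonempty n with h | ⟨⟨i⟩⟩
    · exact ⟨0, Subsingleton.elim _ _⟩
    · refine ⟨l i, ?_⟩
      rw [hd, show (fun k => (l k : ℂ)) = fun _ => (l i : ℂ) from funext fun k => by rw [hcon],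
        ← Matrix.smul_one_eq_diagonal, Matrix.mul_smul, Matrix.smul_mul, Matrix.mul_one, hU']
  obtain ⟨i, k, hik⟩ := hne
  -- Commuting with `H` forces the matrix elements of `a` between eigenvectors of different
  -- eigenvalues to vanish.
  have hent : ∀ a ∈ 𝒜, ∀ x y, l x ≠ l y → (Uᴴ * a * U) x y = 0 := by
    intro a ha x y hxy
    have h1 : Matrix.diagonal (fun i => (l i : ℂ)) * (Uᴴ * a * U) =
        Uᴴ * a * U * Matrix.diagonal (fun i => (l i : ℂ)) := by
      have h2 : Uᴴ * H = Matrix.diagonal (fun i => (l i : ℂ)) * Uᴴ := by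
        rw [hd, ← Matrix.mul_assoc, ← Matrix.mul_assoc, hU, Matrix.one_mul]
      have h3 : H * U = U * Matrix.diagonal (fun i => (l i : ℂ)) := by
        rw [hd, Matrix.mul_assoc, hU, Matrix.mul_one]
      rw [← Matrix.mul_assoc, ← Matrix.mul_assoc, ← h2, Matrix.mul_assoc Uᴴ, hcomm a ha,
        Matrix.mul_assoc (Uᴴ * a), ← h3]
      simp only [Matrix.mul_assoc]
    have h2 := congrFun (congrFun h1 x) y
    rw [Matrix.diagonal_mul, Matrix.mul_diagonal] at h2
    have h3 : ((l x : ℂ) - l y) * (Uᴴ * a * U) x y = 0 := by linear_combination h2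
    refine (mul_eq_zero.mp h3).resolve_left fun h => hxy ?_
    exact_mod_cast sub_eq_zero.mp h
  have hsub : ∀ (q r : n → Prop) [DecidablePred q] [DecidablePred r] (a : Op n),
      (U.submatrix id (Subtype.val : {i // q i} → n))ᴴ * a *
        U.submatrix id (Subtype.val : {i // r i} → n) =
      (Uᴴ * a * U).submatrix Subtype.val Subtype.val := fun q r _ _ a => by
    ext x y
    simp [Matrix.mul_apply]
  have hsub' : ∀ (q r : n → Prop) [DecidablePred q] [DecidablePred r],
      (U.submatrix id (Subtype.val : {i // q i} → n))ᴴ *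
        U.submatrix id (Subtype.val : {i // r i} → n) =
      (1 : Op n).submatrix Subtype.val Subtype.val := fun q r _ _ => by
    simpa [hU] using hsub q r 1
  classical
  refine ⟨fun x => l x = l i, inferInstance, U.submatrix id Subtype.val,
    U.submatrix id Subtype.val, ⟨i, rfl⟩, ⟨k, fun h => hik h.symm⟩, ?_, ?_, ?_, ?_, ?_⟩
  · rw [hsub']
    ext x y
    simp [Matrix.one_apply, Subtype.coe_inj]
  · rw [hsub']
    ext x y
    simp [Matrix.one_apply, Subtype.coe_inj]
  · rw [hsub']
    ext x y
    have : x.1 ≠ y.1 := fun h => y.2 (h ▸ x.2)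
    simp [this]
  · rw [← hU']
    ext x y
    simp only [Matrix.add_apply, Matrix.mul_apply, Matrix.submatrix_apply,
      Matrix.conjTranspose_apply, id]
    exact Fintype.sum_subtype_add_sum_subtype (fun j => l j = l i) (fun j => U x j * star (U y j))
  · intro a ha
    constructor
    · rw [hsub]
      ext x y
      exact hent a ha _ _ fun h => y.2 (h.symm.trans x.2)
    · rw [hsub]
      ext x y
      exact hent a ha _ _ fun h => x.2 (h.trans y.2)

/-- Induction on the dimension: unless the commutant is trivial, an eigenspace of a Hermitian
element and its complement are both invariant and strictly smaller, and the compressions of `𝒜` to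
them are again self-adjoint. -/
lemma exists_irreducibleDecomposition (N : ℕ) : ∀ (n : Type) [Fintype n] [DecidableEq n],
    Fintype.card n = N → ∀ 𝒜 : Set (Op n), (∀ a ∈ 𝒜, aᴴ ∈ 𝒜) →
    ∃ (I : Type) (_ : Fintype I) (d : I → ℕ) (u : ∀ i, Matrix n (Fin (d i)) ℂ),
      IsIrreducibleDecomposition 𝒜 d u := by
  induction N using Nat.strong_induction_on with
  | _ N ih =>
  intro n _ _ hN 𝒜 h𝒜
  by_cases hn : ∀ C : Op n, (∀ a ∈ 𝒜, C * a = a * C) → ∃ c : ℂ, C = c • 1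
  · rcases isEmpty_or_nonempty n with h | h
    · exact ⟨Empty, inferInstance, fun _ => 0, fun i => i.elim, fun i => i.elim, fun i => i.elim,
        fun i => i.elim, Subsingleton.elim _ _, fun _ _ i => i.elim, fun i => i.elim⟩
    · let e := Fintype.equivFin n
      let u : Matrix n (Fin (Fintype.card n)) ℂ := (1 : Op n).submatrix id e.symm
      have hu : uᴴ * u = 1 := by
        simp only [u, Matrix.conjTranspose_submatrix]
        rw [← Matrix.submatrix_mul _ _ _ _ _ Function.bijective_id]
        simp
      have hu' : u * uᴴ = 1 := by
        simp [u, Matrix.conjTranspose_submatrix, Matrix.submatrix_mul_equiv]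
      refine ⟨Unit, inferInstance, fun _ => Fintype.card n, fun _ => u, fun _ => Fintype.card_pos,
        fun _ => hu, fun i k h => (h rfl).elim, by simpa using hu', fun a ha _ => ?_,
        fun _ C hC => ?_⟩
      · rw [← Matrix.mul_assoc, ← Matrix.mul_assoc, hu', Matrix.one_mul]
      · obtain ⟨c, hc⟩ := hn (u * C * uᴴ) fun a ha => by
          have := congrArg (fun X => u * X * uᴴ) (hC a ha)
          simp only [Matrix.mul_assoc, hu', Matrix.mul_one] at this
          simp only [← Matrix.mul_assoc, hu', Matrix.one_mul] at this
          simpa only [Matrix.mul_assoc] using this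
        refine ⟨c, ?_⟩
        have := congrArg (fun X => uᴴ * X * u) hc
        simp only [← Matrix.mul_assoc, hu, Matrix.one_mul] at this
        simpa [Matrix.mul_assoc, hu] using this
  · push Not at hn
    obtain ⟨C, hC, hC'⟩ := hn
    obtain ⟨H, hH, hHc, hHn⟩ := exists_isHermitian_commute h𝒜 hC (by simpa using hC')
    obtain ⟨p, _, u₁, u₂, ⟨x, hx⟩, ⟨y, hy⟩, h11, h22, h12, hsum, hoff⟩ :=
      exists_invariant_splitting hH hHc hHn
    have key : ∀ (m : Type) [Fintype m] [DecidableEq m] (v : Matrix n m ℂ),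
        Fintype.card m < N → ∃ (I : Type) (_ : Fintype I) (d : I → ℕ)
          (u : ∀ i, Matrix m (Fin (d i)) ℂ),
          IsIrreducibleDecomposition ((fun a => vᴴ * a * v) '' 𝒜) d u := by
      intro m _ _ v hm
      refine ih _ hm m rfl _ ?_
      rintro _ ⟨a, ha, rfl⟩
      exact ⟨aᴴ, h𝒜 a ha, by simp [Matrix.mul_assoc]⟩
    obtain ⟨I₁, _, d₁, w₁, hw₁⟩ := key _ u₁ (by rw [← hN]; exact Fintype.card_subtype_lt hy)
    obtain ⟨I₂, _, d₂, w₂, hw₂⟩ := key _ u₂ (by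
      rw [← hN]; exact Fintype.card_subtype_lt (p := fun i => ¬ p i) (not_not.mpr hx))
    have h21 : u₂ᴴ * u₁ = 0 := by simpa using congrArg Matrix.conjTranspose h12
    have e₁ : ∀ i, ∀ a : Op n, (u₁ * w₁ i)ᴴ * a * (u₁ * w₁ i) = (w₁ i)ᴴ * (u₁ᴴ * a * u₁) * w₁ i :=
      fun i a => by simp [Matrix.mul_assoc]
    have e₂ : ∀ i, ∀ a : Op n, (u₂ * w₂ i)ᴴ * a * (u₂ * w₂ i) = (w₂ i)ᴴ * (u₂ᴴ * a * u₂) * w₂ i :=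
      fun i a => by simp [Matrix.mul_assoc]
    have m₁ : ∀ {q : Type} (X : Matrix {i // p i} q ℂ), u₁ᴴ * (u₁ * X) = X := fun X => by
      rw [← Matrix.mul_assoc, h11, Matrix.one_mul]
    have m₂ : ∀ {q : Type} (X : Matrix {i // ¬ p i} q ℂ), u₂ᴴ * (u₂ * X) = X := fun X => by
      rw [← Matrix.mul_assoc, h22, Matrix.one_mul]
    have m₃ : ∀ {q : Type} (X : Matrix {i // ¬ p i} q ℂ), u₁ᴴ * (u₂ * X) = 0 := fun X => by
      rw [← Matrix.mul_assoc, h12, Matrix.zero_mul]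
    have m₄ : ∀ {q : Type} (X : Matrix {i // p i} q ℂ), u₂ᴴ * (u₁ * X) = 0 := fun X => by
      rw [← Matrix.mul_assoc, h21, Matrix.zero_mul]
    refine ⟨I₁ ⊕ I₂, inferInstance, Sum.elim d₁ d₂,
      fun i => match i with | .inl i => u₁ * w₁ i | .inr i => u₂ * w₂ i, ?_, ?_, ?_, ?_, ?_, ?_⟩
    · rintro (i | i)
      · exact hw₁.pos i
      · exact hw₂.pos i
    · rintro (i | i)
      · change (u₁ * w₁ i)ᴴ * (u₁ * w₁ i) = 1
        simpa [Matrix.mul_assoc, m₁] using hw₁.isometry i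
      · change (u₂ * w₂ i)ᴴ * (u₂ * w₂ i) = 1
        simpa [Matrix.mul_assoc, m₂] using hw₂.isometry i
    · rintro (i | i) (k | k) hik
      · change (u₁ * w₁ i)ᴴ * (u₁ * w₁ k) = 0
        simpa [Matrix.mul_assoc, m₁] using hw₁.orthogonal i k (by simpa using hik)
      · change (u₁ * w₁ i)ᴴ * (u₂ * w₂ k) = 0
        simp [Matrix.mul_assoc, m₃]
      · change (u₂ * w₂ i)ᴴ * (u₁ * w₁ k) = 0
        simp [Matrix.mul_assoc, m₄]
      · change (u₂ * w₂ i)ᴴ * (u₂ * w₂ k) = 0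
        simpa [Matrix.mul_assoc, m₂] using hw₂.orthogonal i k (by simpa using hik)
    · have c₁ := congrArg (fun X => u₁ * X * u₁ᴴ) hw₁.complete
      have c₂ := congrArg (fun X => u₂ * X * u₂ᴴ) hw₂.complete
      simp only [Matrix.mul_sum, Matrix.sum_mul, Matrix.mul_one] at c₁ c₂
      rw [Fintype.sum_sum_type, ← hsum, ← c₁, ← c₂]
      change ∑ i, (u₁ * w₁ i) * (u₁ * w₁ i)ᴴ + ∑ i, (u₂ * w₂ i) * (u₂ * w₂ i)ᴴ = _
      simp [Matrix.mul_assoc]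
    · have hinv : ∀ a ∈ 𝒜, a * u₁ = u₁ * (u₁ᴴ * a * u₁) ∧ a * u₂ = u₂ * (u₂ᴴ * a * u₂) := by
        intro a ha
        constructor
        · conv_lhs => rw [← Matrix.one_mul a, ← hsum, Matrix.add_mul, Matrix.add_mul]
          rw [Matrix.mul_assoc u₂, Matrix.mul_assoc u₂, (hoff a ha).2]
          simp [Matrix.mul_assoc]
        · conv_lhs => rw [← Matrix.one_mul a, ← hsum, Matrix.add_mul, Matrix.add_mul]
          rw [Matrix.mul_assoc u₁, Matrix.mul_assoc u₁, (hoff a ha).1]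
          simp [Matrix.mul_assoc]
      rintro a ha (i | i)
      · change a * (u₁ * w₁ i) = (u₁ * w₁ i) * ((u₁ * w₁ i)ᴴ * a * (u₁ * w₁ i))
        rw [e₁, ← Matrix.mul_assoc, (hinv a ha).1, Matrix.mul_assoc,
          hw₁.invariant _ ⟨a, ha, rfl⟩ i]
        simp only [Matrix.mul_assoc]
      · change a * (u₂ * w₂ i) = (u₂ * w₂ i) * ((u₂ * w₂ i)ᴴ * a * (u₂ * w₂ i))
        rw [e₂, ← Matrix.mul_assoc, (hinv a ha).2, Matrix.mul_assoc,
          hw₂.invariant _ ⟨a, ha, rfl⟩ i]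
        simp only [Matrix.mul_assoc]
    · rintro (i | i)
      · refine fun (C : Op (Fin (d₁ i))) hC => hw₁.irreducible i C ?_
        rintro _ ⟨a, ha, rfl⟩
        have := hC a ha
        change C * ((u₁ * w₁ i)ᴴ * a * (u₁ * w₁ i)) =
          ((u₁ * w₁ i)ᴴ * a * (u₁ * w₁ i)) * C at this
        rwa [e₁] at this
      · refine fun (C : Op (Fin (d₂ i))) hC => hw₂.irreducible i C ?_
        rintro _ ⟨a, ha, rfl⟩
        have := hC a ha
        change C * ((u₂ * w₂ i)ᴴ * a * (u₂ * w₂ i)) =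
          ((u₂ * w₂ i)ᴴ * a * (u₂ * w₂ i)) * C at this
        rwa [e₂] at this

end Irreducible

/-! ### Schur's lemma and isotypic components -/

section Isotypic

variable {n : Type} [Fintype n] [DecidableEq n]

/-- Equivalence of two subrepresentations of `𝒜`, embedded by isometries `u` and `v`. -/
def IsEquivalentOn (𝒜 : Set (Op n)) {m m' : Type} [Fintype m] [DecidableEq m] [Fintype m']
    [DecidableEq m'] (u : Matrix n m ℂ) (v : Matrix n m' ℂ) : Prop :=
  ∃ g : Matrix m m' ℂ, gᴴ * g = 1 ∧ g * gᴴ = 1 ∧ ∀ a ∈ 𝒜, (uᴴ * a * u) * g = g * (vᴴ * a * v)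

section

variable {𝒜 : Set (Op n)} {m m' m'' : Type} [Fintype m] [DecidableEq m] [Fintype m']
  [DecidableEq m'] [Fintype m''] [DecidableEq m''] {u : Matrix n m ℂ} {v : Matrix n m' ℂ}
  {w : Matrix n m'' ℂ}

omit [DecidableEq n] in
lemma IsEquivalentOn.refl : IsEquivalentOn 𝒜 u u := ⟨1, by simp, by simp, by simp⟩

omit [DecidableEq n] in
lemma IsEquivalentOn.symm (h : IsEquivalentOn 𝒜 u v) : IsEquivalentOn 𝒜 v u := by
  obtain ⟨g, h1, h2, h3⟩ := h
  refine ⟨gᴴ, by simpa using h2, by simpa using h1, fun a ha => ?_⟩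
  have := congrArg (fun X => gᴴ * X * gᴴ) (h3 a ha)
  simp only [Matrix.mul_assoc, h2, Matrix.mul_one] at this
  simp only [← Matrix.mul_assoc, h1, Matrix.one_mul] at this
  simpa only [Matrix.mul_assoc] using this.symm

omit [DecidableEq n] in
lemma IsEquivalentOn.trans (h : IsEquivalentOn 𝒜 u v) (h' : IsEquivalentOn 𝒜 v w) :
    IsEquivalentOn 𝒜 u w := by
  obtain ⟨g, h1, h2, h3⟩ := h
  obtain ⟨g', h1', h2', h3'⟩ := h'
  refine ⟨g * g', ?_, ?_, fun a ha => ?_⟩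
  · rw [Matrix.conjTranspose_mul, Matrix.mul_assoc, ← Matrix.mul_assoc gᴴ, h1, Matrix.one_mul, h1']
  · rw [Matrix.conjTranspose_mul, Matrix.mul_assoc, ← Matrix.mul_assoc g', h2', Matrix.one_mul, h2]
  · rw [← Matrix.mul_assoc, h3 a ha, Matrix.mul_assoc, h3' a ha, ← Matrix.mul_assoc g g']

omit [DecidableEq n] in
/-- **Schur's lemma**. -/
lemma isEquivalentOn_of_intertwiner (h𝒜 : ∀ a ∈ 𝒜, aᴴ ∈ 𝒜)
    (hu : ∀ C : Op m, (∀ a ∈ 𝒜, C * (uᴴ * a * u) = (uᴴ * a * u) * C) → ∃ c : ℂ, C = c • 1)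
    (hv : ∀ C : Op m', (∀ a ∈ 𝒜, C * (vᴴ * a * v) = (vᴴ * a * v) * C) → ∃ c : ℂ, C = c • 1)
    {Y : Matrix m m' ℂ} (hY : ∀ a ∈ 𝒜, (uᴴ * a * u) * Y = Y * (vᴴ * a * v)) (hY0 : Y ≠ 0) :
    IsEquivalentOn 𝒜 u v := by
  have hY' : ∀ a ∈ 𝒜, Yᴴ * (uᴴ * a * u) = (vᴴ * a * v) * Yᴴ := fun a ha => by
    simpa [Matrix.mul_assoc] using congrArg Matrix.conjTranspose (hY _ (h𝒜 a ha))
  -- `Y†Y` and `YY†` commute with the two irreducible actions, so both are scalars. They are the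
  -- same positive scalar, and dividing `Y` by its square root gives the unitary equivalence.
  obtain ⟨c, hc⟩ := hv (Yᴴ * Y) fun a ha => by
    rw [Matrix.mul_assoc, ← hY a ha, ← Matrix.mul_assoc, hY' a ha, Matrix.mul_assoc]
  obtain ⟨c', hc'⟩ := hu (Y * Yᴴ) fun a ha => by
    rw [Matrix.mul_assoc, hY' a ha, ← Matrix.mul_assoc, ← hY a ha, Matrix.mul_assoc]
  have hcc : c' = c := by
    have h1 : c' • Y = c • Y := by
      calc c' • Y = (Y * Yᴴ) * Y := by rw [hc', Matrix.smul_mul, Matrix.one_mul]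
        _ = c • Y := by rw [Matrix.mul_assoc, hc, Matrix.mul_smul, Matrix.mul_one]
    exact smul_left_injective ℂ hY0 h1
  subst hcc
  have hne : Nonempty m' := by
    by_contra h
    rw [not_nonempty_iff] at h
    exact hY0 (Matrix.ext fun _ j => h.elim j)
  obtain ⟨x⟩ := hne
  have hc0 : 0 ≤ c' := by
    have := (Matrix.posSemidef_conjTranspose_mul_self Y).diag_nonneg (i := x)
    simpa [hc] using this
  have hcne : c' ≠ 0 := by
    rintro rfl
    rw [zero_smul, Matrix.conjTranspose_mul_self_eq_zero] at hc
    exact hY0 hc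
  obtain ⟨r, hr, rfl⟩ : ∃ r : ℝ, 0 < r ∧ (r : ℂ) = c' := by
    refine ⟨c'.re, ?_, ?_⟩
    · exact (Complex.pos_iff.mp (lt_of_le_of_ne hc0 hcne.symm)).1
    · exact Complex.ext rfl (by simpa using (Complex.nonneg_iff.mp hc0).2)
  have hstar : star (((√r : ℝ) : ℂ)⁻¹) = ((√r : ℝ) : ℂ)⁻¹ := by
    rw [← Complex.ofReal_inv, RCLike.star_def, Complex.conj_ofReal]
  have hs : ((√r : ℝ) : ℂ)⁻¹ * (((√r : ℝ) : ℂ)⁻¹ * r) = 1 := by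
    rw [← Complex.ofReal_inv, ← Complex.ofReal_mul, ← Complex.ofReal_mul, ← mul_assoc,
      ← mul_inv, Real.mul_self_sqrt hr.le, inv_mul_cancel₀ hr.ne', Complex.ofReal_one]
  refine ⟨((√r : ℝ) : ℂ)⁻¹ • Y, ?_, ?_, fun a ha => ?_⟩
  · rw [Matrix.conjTranspose_smul, hstar, Matrix.smul_mul, Matrix.mul_smul, hc, smul_smul, smul_smul,
      mul_assoc, hs, one_smul]
  · rw [Matrix.conjTranspose_smul, hstar, Matrix.smul_mul, Matrix.mul_smul, hc', smul_smul, smul_smul,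
      mul_assoc, hs, one_smul]
  · rw [Matrix.mul_smul, hY a ha, Matrix.smul_mul]

end

/-- A unitary `V` decomposing the space into isotypic components `ℂ^(dL j) ⊗ ℂ^(dR j)` of a set `𝒜`
of operators, which act on the right factors by inequivalent irreducible representations `π`. -/
structure IsIsotypicDecomposition (𝒜 : Set (Op n)) {J : ℕ} {dL dR : Fin J → ℕ}
    (V : Matrix n (Blocks dL dR) ℂ) (π : Op n → ∀ j, Op (Fin (dR j))) : Prop where
  isometry : Vᴴ * V = 1
  coisometry : V * Vᴴ = 1
  pos_left : ∀ j, 0 < dL j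
  pos_right : ∀ j, 0 < dR j
  block : ∀ a ∈ 𝒜, Vᴴ * a * V =
    Matrix.blockDiagonal' fun j => (1 : Op (Fin (dL j))) ⊗ₖ π a j
  schur_ne : ∀ j k, j ≠ k → ∀ Y : Matrix (Fin (dR j)) (Fin (dR k)) ℂ,
    (∀ a ∈ 𝒜, π a j * Y = Y * π a k) → Y = 0
  schur : ∀ j, ∀ Y : Op (Fin (dR j)), (∀ a ∈ 𝒜, π a j * Y = Y * π a j) → ∃ c : ℂ, Y = c • 1

/-- The irreducible summands are grouped by unitary equivalence class: the class is `j`, its members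
index the left factor, and the representative carries the right factor. -/
lemma exists_isotypicDecomposition {𝒜 : Set (Op n)} (h𝒜 : ∀ a ∈ 𝒜, aᴴ ∈ 𝒜) :
    ∃ (J : ℕ) (dL dR : Fin J → ℕ) (V : Matrix n (Blocks dL dR) ℂ)
      (π : Op n → ∀ j, Op (Fin (dR j))), IsIsotypicDecomposition 𝒜 V π := by
  classical
  obtain ⟨I, _, d, u, hu⟩ := exists_irreducibleDecomposition _ n rfl 𝒜 h𝒜
  let st : Setoid I := ⟨fun i k => IsEquivalentOn 𝒜 (u i) (u k),
    ⟨fun _ => .refl, fun h => h.symm, fun h h' => h.trans h'⟩⟩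
  let e := (Fintype.equivFin (Quotient st)).symm
  let rep : Fin (Fintype.card (Quotient st)) → I := fun j => (e j).out
  have hrep : ∀ j, (⟦rep j⟧ : Quotient st) = e j := fun j => Quotient.out_eq _
  let f := fun j => (Fintype.equivFin {i : I // (⟦i⟧ : Quotient st) = e j}).symm
  have hg : ∀ j (i : {i : I // (⟦i⟧ : Quotient st) = e j}),
      IsEquivalentOn 𝒜 (u i.1) (u (rep j)) := fun j i =>
    Quotient.exact (s := st) (i.2.trans (hrep j).symm)
  choose g hg1 hg2 hg3 using hg
  -- Absorbing the intertwiner `g` into the embedding makes all copies in one class act by literally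
  -- the same matrices.
  let w : ∀ j, Fin (Fintype.card {i : I // (⟦i⟧ : Quotient st) = e j}) →
    Matrix n (Fin (d (rep j))) ℂ := fun j s => u (f j s).1 * g j (f j s)
  let V : Matrix n (Blocks (fun j => Fintype.card {i : I // (⟦i⟧ : Quotient st) = e j})
    (fun j => d (rep j))) ℂ := Matrix.of fun x y => w y.1 y.2.1 x y.2.2
  have hV : ∀ (X : Op n) j s t k s' t', (Vᴴ * X * V) ⟨j, s, t⟩ ⟨k, s', t'⟩ =
      ((w j s)ᴴ * X * w k s') t t' := fun X j s t k s' t' => by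
    simp [V, Matrix.mul_apply]
  have hne : ∀ j s k s', (⟨j, s⟩ : Σ j, Fin (Fintype.card {i : I // (⟦i⟧ : Quotient st) = e j})) ≠
      ⟨k, s'⟩ → (f j s).1 ≠ (f k s').1 := by
    intro j s k s' h h'
    obtain rfl : j = k := e.injective (by rw [← (f j s).2, ← (f k s').2, h'])
    exact h (by rw [(f j).injective (Subtype.ext h')])
  have hoff : ∀ X : Op n, (∀ i, X * u i = u i * ((u i)ᴴ * X * u i)) → ∀ j s k s',
      (⟨j, s⟩ : Σ j, Fin (Fintype.card {i : I // (⟦i⟧ : Quotient st) = e j})) ≠ ⟨k, s'⟩ →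
      (w j s)ᴴ * X * w k s' = 0 := by
    intro X hX j s k s' h
    simp only [w, Matrix.conjTranspose_mul]
    rw [Matrix.mul_assoc, ← Matrix.mul_assoc X, hX, Matrix.mul_assoc (g j _)ᴴ,
      ← Matrix.mul_assoc (u _)ᴴ, ← Matrix.mul_assoc (u _)ᴴ, hu.orthogonal _ _ (hne j s k s' h)]
    simp
  have hblock : ∀ (X : Op n) (p : ∀ j, Op (Fin (d (rep j)))),
      (∀ i, X * u i = u i * ((u i)ᴴ * X * u i)) →
      (∀ j s, (w j s)ᴴ * X * w j s = p j) →
      Vᴴ * X * V = Matrix.blockDiagonal' fun j =>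
        (1 : Op (Fin (Fintype.card {i : I // (⟦i⟧ : Quotient st) = e j}))) ⊗ₖ p j := by
    intro X p hX hp
    ext ⟨j, s, t⟩ ⟨k, s', t'⟩
    rw [hV]
    by_cases hjk : j = k
    · subst hjk
      rw [Matrix.blockDiagonal'_apply_eq]
      by_cases hs : s = s'
      · subst hs
        simp [hp]
      · rw [hoff X hX]
        · simp [hs]
        · simpa using hs
    · rw [hoff X hX, Matrix.blockDiagonal'_apply_ne _ _ _ hjk]
      · rfl
      · simp [hjk]
  refine ⟨_, _, _, V, fun a j => (u (rep j))ᴴ * a * u (rep j), ?_, ?_, fun j => ?_,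
    fun j => hu.pos _, fun a ha => ?_, fun j k hjk Y hY => ?_, fun j Y hY => ?_⟩
  · have := hblock 1 (fun j => 1) (fun i => by simp [hu.isometry]) fun j s => by
      simp only [w, Matrix.mul_one, Matrix.conjTranspose_mul]
      rw [Matrix.mul_assoc, ← Matrix.mul_assoc (u _)ᴴ, hu.isometry, Matrix.one_mul, hg1]
    simp only [Matrix.mul_one, Matrix.one_kronecker_one] at this
    exact this.trans Matrix.blockDiagonal'_one
  · rw [← hu.complete]
    have h1 : V * Vᴴ = ∑ j, ∑ s, w j s * (w j s)ᴴ := by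
      ext x y
      simp only [V, Matrix.mul_apply, Matrix.sum_apply, Fintype.sum_sigma, Fintype.sum_prod_type,
        Matrix.conjTranspose_apply, Matrix.of_apply]
    have h2 : ∀ j s, w j s * (w j s)ᴴ = u (f j s).1 * (u (f j s).1)ᴴ := fun j s => by
      simp only [w, Matrix.conjTranspose_mul]
      rw [Matrix.mul_assoc, ← Matrix.mul_assoc (g j _), hg2, Matrix.one_mul]
    simp only [h1, h2]
    rw [← Fintype.sum_fiberwise (fun i => (⟦i⟧ : Quotient st)), ← e.sum_comp]
    exact Finset.sum_congr rfl fun j _ => (f j).sum_comp fun i => u i.1 * (u i.1)ᴴ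
  · exact Fintype.card_pos_iff.mpr ⟨⟨rep j, hrep j⟩⟩
  · refine hblock a _ (hu.invariant a ha) fun j s => ?_
    simp only [w, Matrix.conjTranspose_mul]
    calc _ = (g j (f j s))ᴴ * (((u (f j s).1)ᴴ * a * u (f j s).1) * g j (f j s)) := by
          simp only [Matrix.mul_assoc]
      _ = _ := by rw [hg3 j (f j s) a ha, ← Matrix.mul_assoc, hg1, Matrix.one_mul]
  · by_contra hY0
    have := isEquivalentOn_of_intertwiner h𝒜 (hu.irreducible _) (hu.irreducible _) hY hY0
    refine hjk (e.injective ?_)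
    rw [← hrep j, ← hrep k]
    exact Quotient.sound (s := st) this
  · exact hu.irreducible _ Y fun a ha => (hY a ha).symm

end Isotypic

/-! ### Operators commuting with or normalizing a block representation -/

section Blocks

variable {J : ℕ} {dL dR : Fin J → ℕ}

/-- The operator between the right factors cut out by basis vectors of the left factors. -/
def rightBlock (X : Op (Blocks dL dR)) (j : Fin J) (s : Fin (dL j)) (k : Fin J) (s' : Fin (dL k)) :
    Matrix (Fin (dR j)) (Fin (dR k)) ℂ :=
  Matrix.of fun t t' => X ⟨j, s, t⟩ ⟨k, s', t'⟩

lemma rightBlock_mul (X : Op (Blocks dL dR)) (p : ∀ j, Op (Fin (dR j))) (j s k s') :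
    rightBlock (X * Matrix.blockDiagonal' fun j => (1 : Op (Fin (dL j))) ⊗ₖ p j) j s k s' =
      rightBlock X j s k s' * p k := by
  ext t t'
  simp only [rightBlock, Matrix.of_apply, Matrix.mul_apply, Fintype.sum_sigma]
  rw [Finset.sum_eq_single k]
  · simp [Matrix.blockDiagonal'_apply_eq, Fintype.sum_prod_type, Matrix.one_apply]
  · intro l _ hl
    exact Finset.sum_eq_zero fun x _ => by rw [Matrix.blockDiagonal'_apply_ne _ _ _ hl, mul_zero]
  · simp

lemma mul_rightBlock (X : Op (Blocks dL dR)) (p : ∀ j, Op (Fin (dR j))) (j s k s') :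
    rightBlock ((Matrix.blockDiagonal' fun j => (1 : Op (Fin (dL j))) ⊗ₖ p j) * X) j s k s' =
      p j * rightBlock X j s k s' := by
  ext t t'
  simp only [rightBlock, Matrix.of_apply, Matrix.mul_apply, Fintype.sum_sigma]
  rw [Finset.sum_eq_single j]
  · simp [Matrix.blockDiagonal'_apply_eq, Fintype.sum_prod_type, Matrix.one_apply]
  · intro l _ hl
    exact Finset.sum_eq_zero fun x _ => by
      rw [Matrix.blockDiagonal'_apply_ne _ _ _ hl.symm, zero_mul]
  · simp

lemma eq_blockDiagonal'_kronecker {X : Op (Blocks dL dR)} {c : ∀ j, Op (Fin (dL j))}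
    {h : ∀ j, Op (Fin (dR j))} (hne : ∀ j s k s', j ≠ k → rightBlock X j s k s' = 0)
    (heq : ∀ j s s', rightBlock X j s j s' = c j s s' • h j) :
    X = Matrix.blockDiagonal' fun j => c j ⊗ₖ h j := by
  ext ⟨j, s, t⟩ ⟨k, s', t'⟩
  by_cases hjk : j = k
  · subst hjk
    rw [Matrix.blockDiagonal'_apply_eq]
    exact congrFun (congrFun (heq j s s') t) t'
  · rw [Matrix.blockDiagonal'_apply_ne _ _ _ hjk]
    exact congrFun (congrFun (hne j s k s' hjk) t) t'

variable {n : Type} [Fintype n] [DecidableEq n] {𝒜 : Set (Op n)}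
  {V : Matrix n (Blocks dL dR) ℂ} {π : Op n → ∀ j, Op (Fin (dR j))}

lemma conj_mul_conj (hV : V * Vᴴ = 1) (X Y : Op n) :
    (Vᴴ * X * V) * (Vᴴ * Y * V) = Vᴴ * (X * Y) * V := by
  calc _ = Vᴴ * X * (V * Vᴴ) * Y * V := by simp only [Matrix.mul_assoc]
    _ = _ := by rw [hV]; simp [Matrix.mul_assoc]

/-- Each `rightBlock` of `C` intertwines two of the irreducible representations, so Schur's lemma
makes it zero or scalar. -/
lemma IsIsotypicDecomposition.commutant (hV : IsIsotypicDecomposition 𝒜 V π) {C : Op n}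
    (hC : ∀ a ∈ 𝒜, C * a = a * C) : ∃ N : ∀ j, Op (Fin (dL j)),
      Vᴴ * C * V = Matrix.blockDiagonal' fun j => N j ⊗ₖ (1 : Op (Fin (dR j))) := by
  have hint : ∀ a ∈ 𝒜, ∀ j s k s', π a j * rightBlock (Vᴴ * C * V) j s k s' =
      rightBlock (Vᴴ * C * V) j s k s' * π a k := fun a ha j s k s' => by
    rw [← rightBlock_mul, ← mul_rightBlock, ← hV.block a ha, conj_mul_conj hV.coisometry,
      conj_mul_conj hV.coisometry, hC a ha]
  have hs : ∀ j s s', ∃ c : ℂ, rightBlock (Vᴴ * C * V) j s j s' = c • 1 := fun j s s' =>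
    hV.schur j _ fun a ha => hint a ha j s j s'
  choose c hc using hs
  exact ⟨fun j => Matrix.of (c j), eq_blockDiagonal'_kronecker
    (fun j s k s' hjk => hV.schur_ne j k hjk _ fun a ha => hint a ha j s k s') hc⟩

/-- The blocks of `ρ` intertwine `π` with a twisted copy of `π`. One diagonal block `h j` is
invertible and has the same twist, so `(h j)⁻¹` times any block intertwines `π` with itself and
Schur's lemma applies. -/
lemma IsIsotypicDecomposition.normalizer (hV : IsIsotypicDecomposition 𝒜 V π) {ρ : Op n}
    (hρ : ρ.PosDef) (hnorm : ∀ a ∈ 𝒜, ∃ a' ∈ 𝒜, a' * ρ = ρ * a) :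
    ∃ (c : ∀ j, Op (Fin (dL j))) (h : ∀ j, Op (Fin (dR j))), (∀ j, (c j).PosDef) ∧
      (∀ j, (c j).trace = 1) ∧ (∀ j, (h j).PosDef) ∧
      Vᴴ * ρ * V = Matrix.blockDiagonal' fun j => c j ⊗ₖ h j := by
  have hρ' : (Vᴴ * ρ * V).PosDef := by
    refine hρ.conjTranspose_mul_mul_same fun x y hxy => ?_
    simpa [Matrix.mulVec_mulVec, hV.isometry] using congrArg (Vᴴ *ᵥ ·) hxy
  set ρ' := Vᴴ * ρ * V with hρ'def
  have hint : ∀ a ∈ 𝒜, ∃ a' ∈ 𝒜, ∀ j s k s',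
      π a' j * rightBlock ρ' j s k s' = rightBlock ρ' j s k s' * π a k := by
    intro a ha
    obtain ⟨a', ha', h⟩ := hnorm a ha
    refine ⟨a', ha', fun j s k s' => ?_⟩
    rw [← rightBlock_mul, ← mul_rightBlock, ← hV.block a ha, ← hV.block a' ha', hρ'def,
      conj_mul_conj hV.coisometry, conj_mul_conj hV.coisometry, h]
  let s₀ : ∀ j, Fin (dL j) := fun j => ⟨0, hV.pos_left j⟩
  let t₀ : ∀ j, Fin (dR j) := fun j => ⟨0, hV.pos_right j⟩
  let h : ∀ j, Op (Fin (dR j)) := fun j => rightBlock ρ' j (s₀ j) j (s₀ j)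
  have hh : ∀ j, (h j).PosDef := fun j =>
    hρ'.submatrix (e := fun t => (⟨j, s₀ j, t⟩ : Blocks dL dR)) fun t t' htt => by simpa using htt
  have hdet : ∀ j, IsUnit (h j).det := fun j => (Matrix.isUnit_iff_isUnit_det _).mp (hh j).isUnit
  have hint' : ∀ a ∈ 𝒜, ∀ j s k s', π a j * ((h j)⁻¹ * rightBlock ρ' j s k s') =
      ((h j)⁻¹ * rightBlock ρ' j s k s') * π a k := by
    intro a ha j s k s'
    obtain ⟨a', -, h'⟩ := hint a ha
    -- The twist `a ↦ a'` is undone by the inverse of the reference block.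
    have h1 : π a j * (h j)⁻¹ = (h j)⁻¹ * π a' j := by
      calc π a j * (h j)⁻¹ = (h j)⁻¹ * (h j * π a j) * (h j)⁻¹ := by
            rw [← Matrix.mul_assoc, Matrix.nonsing_inv_mul _ (hdet j), Matrix.one_mul]
        _ = (h j)⁻¹ * π a' j := by
            rw [← h' j (s₀ j) j (s₀ j), Matrix.mul_assoc, Matrix.mul_assoc (π a' j),
              Matrix.mul_nonsing_inv _ (hdet j), Matrix.mul_one]
    rw [← Matrix.mul_assoc, h1, Matrix.mul_assoc, h', Matrix.mul_assoc]
  have hinv : ∀ j {k : Fin J} (Y : Matrix (Fin (dR j)) (Fin (dR k)) ℂ),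
      h j * ((h j)⁻¹ * Y) = Y := fun j k Y => by
    rw [← Matrix.mul_assoc, Matrix.mul_nonsing_inv _ (hdet j), Matrix.one_mul]
  have hs : ∀ j s s', ∃ c : ℂ, rightBlock ρ' j s j s' = c • h j := fun j s s' => by
    obtain ⟨c, hc⟩ := hV.schur j _ fun a ha => hint' a ha j s j s'
    exact ⟨c, by rw [← hinv j (rightBlock ρ' j s j s'), hc, Matrix.mul_smul, Matrix.mul_one]⟩
  choose c hc using hs
  have hfac := eq_blockDiagonal'_kronecker (c := fun j => Matrix.of (c j)) (h := h)
    (fun j s k s' hjk => by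
      rw [← hinv j (rightBlock ρ' j s k s'), hV.schur_ne j k hjk _ fun a ha => hint' a ha j s k s',
        Matrix.mul_zero]) hc
  have hcpos : ∀ j, (Matrix.of (c j)).PosDef := by
    intro j
    have hη : 0 < h j (t₀ j) (t₀ j) := (hh j).diag_pos
    have h1 : (ρ'.submatrix (fun s => (⟨j, s, t₀ j⟩ : Blocks dL dR))
        fun s => ⟨j, s, t₀ j⟩).PosDef := hρ'.submatrix fun t t' htt => by simpa using htt
    have h2 : Matrix.of (c j) = (h j (t₀ j) (t₀ j))⁻¹ • ρ'.submatrix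
        (fun s => (⟨j, s, t₀ j⟩ : Blocks dL dR)) fun s => ⟨j, s, t₀ j⟩ := by
      ext s s'
      rw [Matrix.smul_apply, hfac, Matrix.submatrix_apply, Matrix.blockDiagonal'_apply_eq,
        Matrix.kroneckerMap_apply, smul_eq_mul]
      field_simp [hη.ne']
    rw [h2]
    exact h1.smul (inv_pos.mpr hη)
  have hτ : ∀ j, 0 < (Matrix.of (c j)).trace := fun j => by
    have : Nonempty (Fin (dL j)) := ⟨s₀ j⟩
    exact (hcpos j).trace_pos
  refine ⟨fun j => (Matrix.of (c j)).trace⁻¹ • Matrix.of (c j),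
    fun j => (Matrix.of (c j)).trace • h j, fun j => (hcpos j).smul (inv_pos.mpr (hτ j)),
    fun j => ?_, fun j => (hh j).smul (hτ j), hfac.trans ?_⟩
  · rw [Matrix.trace_smul, smul_eq_mul, inv_mul_cancel₀ (hτ j).ne']
  · congr 1
    funext j
    rw [Matrix.smul_kronecker, Matrix.kronecker_smul, smul_smul, inv_mul_cancel₀ (hτ j).ne',
      one_smul]

end Blocks

/-! ### The Koashi–Imoto theorem -/

/-- The Koashi–Imoto theorem for a set of operators containing a faithful state. -/
theorem exists_koashiImoto_form {n : Type} [Fintype n] [DecidableEq n] {S : Set (Op n)} {ρ₀ : Op n}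
    (hρ₀ : ρ₀ ∈ S) (hpos : ρ₀.PosDef) :
    ∃ (J : ℕ) (dL dR : Fin J → ℕ) (V : Matrix n (Blocks dL dR) ℂ) (ω : ∀ j, Op (Fin (dL j))),
      Vᴴ * V = 1 ∧ V * Vᴴ = 1 ∧ (∀ j, 0 < dR j) ∧ (∀ j, (ω j).PosDef) ∧ (∀ j, (ω j).trace = 1) ∧
      (∀ ρ ∈ S, ∃ X : ∀ j, Op (Fin (dR j)),
        Vᴴ * ρ * V = Matrix.blockDiagonal' fun j => ω j ⊗ₖ X j) ∧
      ∀ (k : ℕ) (M : Fin k → Op n), IsMeasurement M → (∀ ρ ∈ S, krausMap M ρ = ρ) →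
        ∃ N : ∀ j, Fin k → Op (Fin (dL j)), ∀ i,
          Vᴴ * M i * V = Matrix.blockDiagonal' fun j => N j i ⊗ₖ (1 : Op (Fin (dR j))) := by
  -- The operators commuting with everything that any channel preserving all of `S` can do: the
  -- information no such channel touches.
  let 𝒜 : Set (Op n) := {X | ∀ (k : ℕ) (M : Fin k → Op n), IsMeasurement M →
    (∀ ρ ∈ S, krausMap M ρ = ρ) → X ∈ krausCommutant M}
  have hdet : IsUnit ρ₀.det := (Matrix.isUnit_iff_isUnit_det _).mp hpos.isUnit
  have h𝒜 : ∀ a ∈ 𝒜, aᴴ ∈ 𝒜 := fun a ha k M hM hS i => by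
    have h1 := congrArg Matrix.conjTranspose (ha k M hM hS i).1
    have h2 := congrArg Matrix.conjTranspose (ha k M hM hS i).2
    simp only [Matrix.conjTranspose_mul, Matrix.conjTranspose_conjTranspose] at h1 h2
    exact ⟨h2.symm, h1.symm⟩
  have hS𝒜 : ∀ ρ ∈ S, ρ₀⁻¹ * ρ ∈ 𝒜 := fun ρ hρ k M hM hS => by
    obtain ⟨X, hX, rfl⟩ := (exists_mul_of_krausMap_eq hM hpos (hS ρ₀ hρ₀) (hS ρ hρ)).1
    rwa [← Matrix.mul_assoc, Matrix.nonsing_inv_mul _ hdet, Matrix.one_mul]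
  have hnorm : ∀ a ∈ 𝒜, ∃ a' ∈ 𝒜, a' * ρ₀ = ρ₀ * a := fun a ha => by
    refine ⟨ρ₀ * a * ρ₀⁻¹, fun k M hM hS => ?_, by
      rw [Matrix.mul_assoc, Matrix.nonsing_inv_mul _ hdet, Matrix.mul_one]⟩
    -- `ρ₀a` is a fixed point, hence also of the form `Xρ₀` with `X` in the commutant, so `ρ₀aρ₀⁻¹ =
    -- X`.
    obtain ⟨X, hX, h⟩ := (exists_mul_of_krausMap_eq hM hpos (hS ρ₀ hρ₀)
      (krausMap_mul_of_mem_krausCommutant (hS ρ₀ hρ₀) (ha k M hM hS))).2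
    rwa [← h, Matrix.mul_assoc, Matrix.mul_nonsing_inv _ hdet, Matrix.mul_one]
  obtain ⟨J, dL, dR, V, π, hV⟩ := exists_isotypicDecomposition h𝒜
  obtain ⟨ω, h, hω, htr, -, hρV⟩ := hV.normalizer hpos hnorm
  refine ⟨J, dL, dR, V, ω, hV.isometry, hV.coisometry, hV.pos_right, hω, htr, fun ρ hρ => ?_,
    fun k M hM hS => ?_⟩
  · refine ⟨fun j => h j * π (ρ₀⁻¹ * ρ) j, ?_⟩
    have h1 : ρ = ρ₀ * (ρ₀⁻¹ * ρ) := by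
      rw [← Matrix.mul_assoc, Matrix.mul_nonsing_inv _ hdet, Matrix.one_mul]
    conv_lhs => rw [h1]
    rw [← conj_mul_conj hV.coisometry, hρV, hV.block _ (hS𝒜 ρ hρ), ← Matrix.blockDiagonal'_mul]
    simp [← Matrix.mul_kronecker_mul]
  · have := fun i => hV.commutant (C := M i) fun a ha => (ha k M hM hS i).1
    choose N hN using this
    exact ⟨fun j i => N i j, hN⟩

lemma range_mulVecLin_le {l m n : Type} [Fintype m] [Fintype n] {X : Matrix l m ℂ}
    {Y : Matrix l n ℂ} {Z : Matrix n m ℂ} (h : X = Y * Z) :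
    LinearMap.range X.mulVecLin ≤ LinearMap.range Y.mulVecLin := by
  rw [h, Matrix.mulVecLin_mul]
  exact LinearMap.range_comp_le_range _ _

lemma supp_conj_diagonal {m n : Type} [Fintype m] [Fintype n] [DecidableEq m] {V : Matrix n m ℂ}
    (hV : Vᴴ * V = 1) {d : m → ℂ} (hd : ∀ i, d i ≠ 0) {ρ : Op n}
    (hρ : ρ = V * Matrix.diagonal d * Vᴴ) : supp ρ = LinearMap.range V.mulVecLin := by
  refine le_antisymm (range_mulVecLin_le (hρ.trans (Matrix.mul_assoc _ _ _)))
    (range_mulVecLin_le (Z := V * Matrix.diagonal fun i => (d i)⁻¹) ?_)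
  rw [hρ, Matrix.mul_assoc, ← Matrix.mul_assoc Vᴴ, hV, Matrix.one_mul, Matrix.mul_assoc,
    Matrix.diagonal_mul_diagonal]
  simp [hd]

section

variable {J : ℕ} {dL dR : Fin J → ℕ}

lemma blockDiagonal'_sum {dL' dR' : Fin J → ℕ} {ι : Type} [Fintype ι]
    (f : ι → ∀ j, Matrix (Fin (dL j) × Fin (dR j)) (Fin (dL' j) × Fin (dR' j)) ℂ) :
    ∑ i, Matrix.blockDiagonal' (f i) = Matrix.blockDiagonal' fun j => ∑ i, f i j := by
  ext ⟨j, s⟩ ⟨k, t⟩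
  rw [Matrix.sum_apply]
  by_cases h : j = k
  · subst h
    simp [Matrix.blockDiagonal'_apply_eq, Matrix.sum_apply]
  · simp [Matrix.blockDiagonal'_apply_ne _ _ _ h]

lemma sum_kronecker {ι l m n p : Type} [Fintype ι] (f : ι → Matrix l m ℂ) (Y : Matrix n p ℂ) :
    ∑ i, f i ⊗ₖ Y = (∑ i, f i) ⊗ₖ Y := by
  ext x y
  simp [Matrix.sum_apply, Finset.sum_mul]

lemma kronecker_sum {ι l m n p : Type} [Fintype ι] (X : Matrix l m ℂ) (f : ι → Matrix n p ℂ) :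
    ∑ i, X ⊗ₖ f i = X ⊗ₖ ∑ i, f i := by
  ext x y
  simp [Matrix.sum_apply, Finset.mul_sum]

lemma trace_blockDiagonal'_kronecker (ω : ∀ j, Op (Fin (dL j))) (X : ∀ j, Op (Fin (dR j))) :
    (Matrix.blockDiagonal' fun j => ω j ⊗ₖ X j).trace = ∑ j, (ω j).trace * (X j).trace := by
  simp [Matrix.trace_blockDiagonal', Matrix.trace_kronecker]

lemma kronecker_right_eq_traceFst {m n : Type} [Fintype m] {ω : Op m} (hω : ω.trace = 1) (X : Op n) :
    X = traceFst (ω ⊗ₖ X) := by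
  ext x y
  simp only [traceFst, Matrix.of_apply, Matrix.kroneckerMap_apply, ← Finset.sum_mul]
  rw [show ∑ i, ω i i = 1 from hω, one_mul]

lemma traceFst_posSemidef {m n : Type} [Fintype m] {ρ : Op (m × n)} (hρ : ρ.PosSemidef) :
    (traceFst ρ).PosSemidef := by
  have : traceFst ρ = ∑ i, ρ.submatrix (Prod.mk i) (Prod.mk i) := by
    ext x y
    simp [traceFst, Matrix.sum_apply]
  rw [this]
  exact Matrix.posSemidef_sum _ fun i _ => hρ.submatrix _

lemma posSemidef_of_blockDiagonal' {ω : ∀ j, Op (Fin (dL j))} (hω : ∀ j, (ω j).trace = 1)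
    {X : ∀ j, Op (Fin (dR j))}
    (h : (Matrix.blockDiagonal' fun j => ω j ⊗ₖ X j).PosSemidef) (j : Fin J) :
    (X j).PosSemidef := by
  rw [kronecker_right_eq_traceFst (hω j) (X j)]
  refine traceFst_posSemidef ?_
  have := h.submatrix (Sigma.mk j)
  convert this using 1
  ext x y
  simp [Matrix.blockDiagonal'_apply_eq]

end

lemma isDensity_smul_one {d : ℕ} (hd : 0 < d) : IsDensity ((d : ℂ)⁻¹ • (1 : Op (Fin d))) := by
  have hd' : (d : ℂ) ≠ 0 := by exact_mod_cast hd.ne'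
  refine ⟨Matrix.PosSemidef.one.smul ?_, ?_⟩
  · rw [inv_nonneg]
    exact_mod_cast d.zero_le
  · simp [Matrix.trace_smul, hd']

/-- A positive operator is a nonnegative multiple of a density operator. -/
lemma exists_eq_smul_isDensity {d : ℕ} (hd : 0 < d) {X : Op (Fin d)} (hX : X.PosSemidef) :
    ∃ (p : ℝ) (φ : Op (Fin d)), 0 ≤ p ∧ (p : ℂ) = X.trace ∧ IsDensity φ ∧ X = (p : ℂ) • φ := by
  obtain ⟨p, hp, hpX⟩ : ∃ p : ℝ, 0 ≤ p ∧ (p : ℂ) = X.trace := by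
    have := Complex.nonneg_iff.mp hX.trace_nonneg
    exact ⟨X.trace.re, this.1, Complex.ext rfl (by simpa using this.2)⟩
  by_cases h0 : p = 0
  -- With weight zero any density operator serves; the maximally mixed one is taken.
  · refine ⟨p, _, hp, hpX, isDensity_smul_one hd, ?_⟩
    rw [h0, Complex.ofReal_zero] at hpX
    rw [h0, Complex.ofReal_zero, zero_smul, hX.trace_eq_zero_iff.mp hpX.symm]
  · have h0' : (p : ℂ) ≠ 0 := by exact_mod_cast h0
    refine ⟨p, (p : ℂ)⁻¹ • X, hp, hpX, ⟨hX.smul ?_, ?_⟩, ?_⟩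
    · rw [inv_nonneg]
      exact_mod_cast hp
    · rw [Matrix.trace_smul, ← hpX, smul_eq_mul, inv_mul_cancel₀ h0']
    · rw [smul_smul, mul_inv_cancel₀ h0', one_smul]

/-- The **Koashi–Imoto theorem** for a set of states whose joint support is that of one of its
elements. -/
theorem exists_isKoashiImoto {A : Type} [Fintype A] [DecidableEq A] {S : Set (Op A)} {m : ℕ}
    {V₀ : Matrix A (Fin m) ℂ} (hV₀ : V₀ᴴ * V₀ = 1) {d : Fin m → ℝ} (hd : ∀ i, 0 < d i)
    (hmem : V₀ * Matrix.diagonal (fun i => (d i : ℂ)) * V₀ᴴ ∈ S) (hS : ∀ ρ ∈ S, IsDensity ρ)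
    (hsupp : ∀ ρ ∈ S, V₀ * V₀ᴴ * ρ = ρ) :
    ∃ (J : ℕ) (dL dR : Fin J → ℕ) (V : Matrix A (Blocks dL dR) ℂ) (ω : ∀ j, Op (Fin (dL j))),
      IsKoashiImoto S V ω ∧ V * Vᴴ = V₀ * V₀ᴴ ∧ (∀ j, (ω j).PosDef) ∧ (∀ j, 0 < dR j) ∧
      ∀ ρ ∈ S, ∃ X : ∀ j, Op (Fin (dR j)),
        Vᴴ * ρ * V = Matrix.blockDiagonal' fun j => ω j ⊗ₖ X j := by
  set ρ₀ := V₀ * Matrix.diagonal (fun i => (d i : ℂ)) * V₀ᴴ with hρ₀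
  have hc₀ : V₀ᴴ * ρ₀ * V₀ = Matrix.diagonal (fun i => (d i : ℂ)) := by
    rw [hρ₀, Matrix.mul_assoc, Matrix.mul_assoc (V₀ * _), hV₀, ← Matrix.mul_assoc,
      ← Matrix.mul_assoc, hV₀]
    simp
  have hpos : (Matrix.diagonal (fun i => (d i : ℂ))).PosDef :=
    Matrix.PosDef.diagonal fun i => by exact_mod_cast hd i
  -- Compressed by `V₀` to the joint support, `ρ₀` becomes faithful. The unitary `V₁` found there is
  -- embedded back into `A` as `V₀ * V₁`.
  obtain ⟨J, dL, dR, V₁, ω, hV₁, hV₁', hdR, hω, htr, hform, hmax⟩ :=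
    exists_koashiImoto_form (S := (fun ρ => V₀ᴴ * ρ * V₀) '' S) ⟨ρ₀, hmem, hc₀⟩ hpos
  have hcompress : ∀ ρ : Op A, (V₀ * V₁)ᴴ * ρ * (V₀ * V₁) = V₁ᴴ * (V₀ᴴ * ρ * V₀) * V₁ := fun ρ => by
    simp [Matrix.mul_assoc]
  have hVV : (V₀ * V₁) * (V₀ * V₁)ᴴ = V₀ * V₀ᴴ := by
    rw [Matrix.conjTranspose_mul, Matrix.mul_assoc, ← Matrix.mul_assoc V₁, hV₁', Matrix.one_mul]
  have hiso : (V₀ * V₁)ᴴ * (V₀ * V₁) = 1 := by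
    rw [Matrix.conjTranspose_mul, Matrix.mul_assoc, ← Matrix.mul_assoc V₀ᴴ, hV₀, Matrix.one_mul,
      hV₁]
  have hform' : ∀ ρ ∈ S, ∃ X : ∀ j, Op (Fin (dR j)),
      (V₀ * V₁)ᴴ * ρ * (V₀ * V₁) = Matrix.blockDiagonal' fun j => ω j ⊗ₖ X j := fun ρ hρ => by
    rw [hcompress]
    exact hform _ ⟨ρ, hρ, rfl⟩
  have hrec : ∀ ρ ∈ S, (V₀ * V₁) * ((V₀ * V₁)ᴴ * ρ * (V₀ * V₁)) * (V₀ * V₁)ᴴ = ρ := by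
    intro ρ hρ
    have h1 : ρ * (V₀ * V₀ᴴ) = ρ := by
      have := congrArg Matrix.conjTranspose (hsupp ρ hρ)
      simpa [(hS ρ hρ).1.isHermitian.eq] using this
    calc _ = ((V₀ * V₁) * (V₀ * V₁)ᴴ) * ρ * ((V₀ * V₁) * (V₀ * V₁)ᴴ) := by
          simp only [Matrix.mul_assoc]
      _ = ρ := by rw [hVV, hsupp ρ hρ, h1]
  refine ⟨J, dL, dR, V₀ * V₁, ω, ⟨hiso, ?_, fun j => ⟨(hω j).posSemidef, htr j⟩, ?_, ?_⟩, hVV, hω,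
    hdR, hform'⟩
  · have h1 : LinearMap.range (V₀ * V₁).mulVecLin = LinearMap.range V₀.mulVecLin :=
      le_antisymm (range_mulVecLin_le rfl) (range_mulVecLin_le (Z := V₁ᴴ) (by
        rw [Matrix.mul_assoc, hV₁', Matrix.mul_one]))
    rw [h1]
    refine le_antisymm ?_ (iSup₂_le fun ρ hρ => ?_)
    · rw [← supp_conj_diagonal hV₀ (d := fun i => (d i : ℂ))
        (fun i => by exact_mod_cast (hd i).ne') hρ₀]
      exact le_iSup₂ (f := fun (ρ : Op A) (_ : ρ ∈ S) => supp ρ) ρ₀ hmem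
    · exact range_mulVecLin_le (Z := V₀ᴴ * ρ) (by rw [← Matrix.mul_assoc, hsupp ρ hρ])
  · intro ρ hρ
    obtain ⟨X, hX⟩ := hform' ρ hρ
    have hpsd : (Matrix.blockDiagonal' fun j => ω j ⊗ₖ X j).PosSemidef := by
      rw [← hX]
      exact (hS ρ hρ).1.conjTranspose_mul_mul_same _
    choose p φ hp hpX hφ hXφ using fun j =>
      exists_eq_smul_isDensity (hdR j) (posSemidef_of_blockDiagonal' htr hpsd j)
    refine ⟨p, φ, hp, ?_, hφ, ?_⟩
    · have h1 : (∑ j, (p j : ℂ)) = 1 := by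
        rw [← (hS ρ hρ).2]
        conv_rhs => rw [← hrec ρ hρ, Matrix.trace_mul_comm, ← Matrix.mul_assoc, hiso,
          Matrix.one_mul, hX, trace_blockDiagonal'_kronecker]
        simp [htr, hpX]
      exact_mod_cast h1
    · conv_lhs => rw [← hrec ρ hρ, hX]
      congr 3
      funext j
      conv_lhs => rw [hXφ j]
      rw [Matrix.kronecker_smul]
  · intro k M hM hfix
    have hconj : ∀ X Y : Op (Blocks dL dR), (V₁ * X * V₁ᴴ) * (V₁ * Y * V₁ᴴ) = V₁ * (X * Y) * V₁ᴴ := by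
      intro X Y
      calc _ = V₁ * X * (V₁ᴴ * V₁) * Y * V₁ᴴ := by simp only [Matrix.mul_assoc]
        _ = _ := by rw [hV₁]; simp [Matrix.mul_assoc]
    have hback : ∀ X : Op (Blocks dL dR), V₁ᴴ * (V₁ * X * V₁ᴴ) * V₁ = X := by
      intro X
      calc _ = (V₁ᴴ * V₁) * X * (V₁ᴴ * V₁) := by simp only [Matrix.mul_assoc]
        _ = _ := by simp [hV₁]
    have hstar : ∀ X : Op (Blocks dL dR), (V₁ * X * V₁ᴴ)ᴴ = V₁ * Xᴴ * V₁ᴴ := fun X => by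
      simp [Matrix.mul_assoc]
    -- Kraus operators given in block coordinates are moved by the unitary `V₁` to the compressed
    -- space, where maximality is known.
    obtain ⟨N, hN⟩ := hmax k (fun i => V₁ * M i * V₁ᴴ) (by
      simp only [IsMeasurement, hstar, hconj, ← Matrix.mul_sum, ← Matrix.sum_mul]
      rw [show ∑ i, (M i)ᴴ * M i = 1 from hM, Matrix.mul_one, hV₁']) (by
      rintro _ ⟨ρ, hρ, rfl⟩
      have h1 := hfix ρ hρ
      have h2 : V₀ᴴ * ρ * V₀ = V₁ * ((V₀ * V₁)ᴴ * ρ * (V₀ * V₁)) * V₁ᴴ := by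
        rw [hcompress]
        calc _ = (V₁ * V₁ᴴ) * (V₀ᴴ * ρ * V₀) * (V₁ * V₁ᴴ) := by simp [hV₁']
          _ = _ := by simp only [Matrix.mul_assoc]
      rw [krausMap_apply] at h1 ⊢
      simp only
      rw [h2]
      simp only [hstar, hconj, ← Matrix.mul_sum, ← Matrix.sum_mul, h1])
    simp only [hback] at hN
    obtain ⟨X, hX⟩ := hform' ρ₀ hmem
    have hXpos : (Matrix.blockDiagonal' fun j => ω j ⊗ₖ X j).PosDef := by
      rw [← hX, hcompress, hc₀]
      refine hpos.conjTranspose_mul_mul_same fun x y hxy => ?_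
      simpa [Matrix.mulVec_mulVec, hV₁] using congrArg (V₁ᴴ *ᵥ ·) hxy
    have hdL : ∀ j, 0 < dL j := fun j => Nat.pos_of_ne_zero fun h => by
      have : IsEmpty (Fin (dL j)) := by rw [h]; infer_instance
      simpa [Matrix.trace] using htr j
    refine ⟨N, fun j => ?_, fun j => ?_, hN⟩
    · have h1 : (∑ i, (M i)ᴴ * M i) = 1 := hM
      simp only [hN, Matrix.blockDiagonal'_conjTranspose, ← Matrix.blockDiagonal'_mul,
        Matrix.conjTranspose_kronecker, ← Matrix.mul_kronecker_mul, blockDiagonal'_sum,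
        Matrix.conjTranspose_one, Matrix.mul_one, sum_kronecker] at h1
      rw [IsMeasurement]
      ext s s'
      have h2 := congrFun (congrFun h1 ⟨j, s, ⟨0, hdR j⟩⟩) ⟨j, s', ⟨0, hdR j⟩⟩
      rw [Matrix.blockDiagonal'_apply_eq] at h2
      simpa [Matrix.one_apply] using h2
    · have h1 := hfix ρ₀ hmem
      simp only [krausMap_apply, hX, hN, Matrix.blockDiagonal'_conjTranspose,
        ← Matrix.blockDiagonal'_mul, Matrix.conjTranspose_kronecker, ← Matrix.mul_kronecker_mul,
        blockDiagonal'_sum, Matrix.conjTranspose_one, Matrix.mul_one, Matrix.one_mul,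
        sum_kronecker] at h1
      rw [krausMap_apply]
      ext s s'
      have h2 := congrFun (congrFun h1 ⟨j, s, ⟨0, hdR j⟩⟩) ⟨j, s', ⟨0, hdR j⟩⟩
      rw [Matrix.blockDiagonal'_apply_eq, Matrix.blockDiagonal'_apply_eq,
        Matrix.kroneckerMap_apply, Matrix.kroneckerMap_apply] at h2
      -- The common factor is a diagonal entry of `X j`; it is nonzero because the compressed `ρ₀`
      -- is faithful.
      refine mul_right_cancel₀ (fun h0 => ?_) h2
      have h3 := hXpos.diag_pos (i := ⟨j, ⟨0, hdL j⟩, ⟨0, hdR j⟩⟩)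
      rw [Matrix.blockDiagonal'_apply_eq, Matrix.kroneckerMap_apply] at h3
      simp [h0] at h3

/-! ### Steering and purification of tripartite states -/

open scoped Matrix.Norms.L2Operator MatrixOrder in
-- Extends block forms, known for positive effects on `R` only, to matrix units by linearity.
lemma span_posSemidef (n : Type) [Fintype n] [DecidableEq n] :
    Submodule.span ℂ {Λ : Op n | Λ.PosSemidef} = ⊤ := by
  have := CStarAlgebra.span_nonneg (A := Op n)
  simpa [Matrix.nonneg_iff_posSemidef] using this

/-- Two families with the same Gram operators are related by a coisometry, if the first one has
full column rank. -/
lemma exists_coisometry_of_gram_eq {ι a b c : Type} [Fintype ι] [Fintype a] [Fintype b]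
    [Fintype c] [DecidableEq c] {Z : ι → Matrix a c ℂ} {Ψ : ι → Matrix a b ℂ} {D : c → ℂ}
    (hD : ∀ i, D i ≠ 0) (hZ : ∑ r, (Z r)ᴴ * Z r = Matrix.diagonal D)
    (hZΨ : ∀ r r', Z r * (Z r')ᴴ = Ψ r * (Ψ r')ᴴ) :
    ∃ L : Matrix c b ℂ, L * Lᴴ = 1 ∧ ∀ r, Z r * L = Ψ r := by
  let D' := Matrix.diagonal fun i => (D i)⁻¹
  have h1 : D' * Matrix.diagonal D = 1 := by
    simp [D', Matrix.diagonal_mul_diagonal, hD]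
  let L := D' * ∑ r, (Z r)ᴴ * Ψ r
  have hL : ∀ r, L * (Ψ r)ᴴ = (Z r)ᴴ := fun r => by
    simp only [L, Matrix.mul_assoc, Matrix.sum_mul, ← hZΨ]
    simp only [← Matrix.mul_assoc, ← Matrix.sum_mul, hZ]
    rw [h1, Matrix.one_mul]
  have hLL : L * Lᴴ = 1 := by
    have h2 : L * (∑ r, (Z r)ᴴ * Ψ r)ᴴ = Matrix.diagonal D := by
      simp only [Matrix.conjTranspose_sum, Matrix.conjTranspose_mul,
        Matrix.conjTranspose_conjTranspose, Matrix.mul_sum, ← Matrix.mul_assoc, hL, hZ]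
    have h3 : D'ᴴ = D' := by
      have h4 := congrArg Matrix.conjTranspose h1
      have h5 : (Matrix.diagonal D)ᴴ = Matrix.diagonal D := by
        rw [← hZ]
        simp [Matrix.conjTranspose_sum]
      rw [Matrix.conjTranspose_mul, h5, Matrix.conjTranspose_one] at h4
      calc D'ᴴ = D' * Matrix.diagonal D * D'ᴴ := by rw [h1, Matrix.one_mul]
        _ = D' := by rw [Matrix.mul_assoc, h4, Matrix.mul_one]
    calc L * Lᴴ = L * (∑ r, (Z r)ᴴ * Ψ r)ᴴ * D'ᴴ := by
          rw [show Lᴴ = (∑ r, (Z r)ᴴ * Ψ r)ᴴ * D'ᴴ from Matrix.conjTranspose_mul _ _,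
            ← Matrix.mul_assoc]
      _ = 1 := by rw [h2, h3, mul_eq_one_comm.mp h1]
  -- The difference `Ψ r - Z r * L` has vanishing Gram operator.
  refine ⟨L, hLL, fun r => sub_eq_zero.mp ?_⟩
  have hL' : Ψ r * Lᴴ = Z r := by simpa using congrArg Matrix.conjTranspose (hL r)
  rw [← Matrix.self_mul_conjTranspose_eq_zero, Matrix.conjTranspose_sub, Matrix.conjTranspose_mul,
    Matrix.mul_sub, Matrix.sub_mul, Matrix.sub_mul, Matrix.mul_assoc, ← Matrix.mul_assoc L, hLL,
    Matrix.one_mul, ← Matrix.mul_assoc (Ψ r), hL', Matrix.mul_assoc, hL, hZΨ]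
  simp

section Tripartite

variable {R A B : Type} [Fintype R] [Fintype A] [Fintype B]

/-- The operator from `B` to `A` representing the (unnormalized) state of `A ⊗ B` given the basis
state `r` of `R`. -/
def slice (ψ : R × A × B → ℂ) (r : R) : Matrix A B ℂ := Matrix.of fun a b => ψ (r, a, b)

lemma steer_eq_sum [DecidableEq A] (ψ : R × A × B → ℂ) (Λ : Op R) :
    steer ψ Λ = ∑ r, ∑ r', Λ r r' • (slice ψ r' * (slice ψ r)ᴴ) := by
  ext a a'
  simp only [steer, traceFst, Matrix.of_apply, Matrix.mul_apply, Fintype.sum_prod_type,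
    Matrix.sum_apply, Matrix.smul_apply]
  refine Finset.sum_congr rfl fun r _ => Finset.sum_congr rfl fun r' _ => ?_
  simp [Matrix.one_apply, stateRA, traceSnd, proj, Matrix.vecMulVec_apply, slice]

lemma steer_one [DecidableEq A] [DecidableEq R] (ψ : R × A × B → ℂ) :
    steer ψ 1 = ∑ r, slice ψ r * (slice ψ r)ᴴ := by
  simp [steer_eq_sum, Matrix.one_apply]

lemma steer_single [DecidableEq A] [DecidableEq R] (ψ : R × A × B → ℂ) (r r' : R) :
    steer ψ (Matrix.single r r' 1) = slice ψ r' * (slice ψ r)ᴴ := by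
  rw [steer_eq_sum, Finset.sum_eq_single r, Finset.sum_eq_single r']
  · simp
  · intro x _ hx
    simp [hx.symm]
  · simp
  · intro x _ hx
    simp [hx.symm]
  · simp

/-- Writing `Λ = XX†` turns the double sum over `R` into a sum of squares, one for each column of
`X`. -/
lemma steer_posSemidef [DecidableEq A] (ψ : R × A × B → ℂ) {Λ : Op R} (hΛ : Λ.PosSemidef) :
    (steer ψ Λ).PosSemidef := by
  classical
  obtain ⟨m, X, -, -, -, rfl⟩ := exists_mul_conjTranspose_eq hΛ
  have : steer ψ (X * Xᴴ) =
      ∑ k, (∑ r, star (X r k) • slice ψ r) * (∑ r, star (X r k) • slice ψ r)ᴴ := by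
    rw [steer_eq_sum]
    simp only [Matrix.mul_apply, Matrix.conjTranspose_sum, Matrix.conjTranspose_smul, star_star,
      Matrix.sum_mul, Matrix.mul_sum, Matrix.smul_mul, Matrix.mul_smul,
      Matrix.conjTranspose_apply, Finset.sum_smul]
    rw [Finset.sum_comm]
    conv_lhs => enter [2, x]; rw [Finset.sum_comm]
    rw [Finset.sum_comm]
    refine Finset.sum_congr rfl fun k _ => ?_
    rw [Finset.sum_comm]
    simp only [Finset.smul_sum, smul_smul]
  rw [this]
  exact Matrix.posSemidef_sum _ fun k _ => Matrix.posSemidef_self_mul_conjTranspose _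

lemma steer_one_trace [DecidableEq A] [DecidableEq R] {ψ : R × A × B → ℂ} (hψ : IsKet ψ) :
    (steer ψ 1).trace = 1 := by
  have h : (∑ i, (‖ψ i‖ ^ 2 : ℝ) : ℂ) = 1 := by exact_mod_cast hψ
  rw [← h, steer_one]
  simp [Matrix.trace, Matrix.sum_apply, Matrix.mul_apply, slice, Fintype.sum_prod_type,
    Complex.mul_conj, Complex.normSq_eq_norm_sq]
  rw [Finset.sum_comm]

lemma isDensity_of_mem_steeredStates [DecidableEq A] {ψ : R × A × B → ℂ} {ρ : Op A}
    (hρ : ρ ∈ steeredStates ψ) : IsDensity ρ := by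
  obtain ⟨Λ, hΛ, htr, rfl⟩ := hρ
  refine ⟨(steer_posSemidef ψ hΛ).smul (inv_nonneg.mpr (steer_posSemidef ψ hΛ).trace_nonneg), ?_⟩
  rw [Matrix.trace_smul, smul_eq_mul, inv_mul_cancel₀ htr]

omit [Fintype B] in
lemma stateB_eq_sum (ψ : R × A × B → ℂ) :
    stateB ψ = ∑ r, (slice ψ r)ᵀ * ((slice ψ r)ᵀ)ᴴ := by
  ext b b'
  simp only [stateB, traceFst, proj, Matrix.of_apply, Matrix.vecMulVec_apply, Matrix.sum_apply,
    Matrix.mul_apply, slice, Matrix.transpose_apply, Matrix.conjTranspose_apply, Pi.star_apply]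
  rw [Finset.sum_comm]

/-- The positive operators `((P - 1)ψ_r)((P - 1)ψ_r)†` add up to zero, so each of them vanishes. -/
lemma sum_mul_slice_eq {ψ : R × A × B → ℂ} [DecidableEq A] {P : Op A}
    (hP : P * ∑ r, slice ψ r * (slice ψ r)ᴴ = ∑ r, slice ψ r * (slice ψ r)ᴴ) (r : R) :
    P * slice ψ r = slice ψ r := by
  have h0 : ∑ r, ((P - 1) * slice ψ r) * ((P - 1) * slice ψ r)ᴴ = 0 := by
    have : ∀ r, ((P - 1) * slice ψ r) * ((P - 1) * slice ψ r)ᴴ =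
        (P - 1) * (slice ψ r * (slice ψ r)ᴴ) * (P - 1)ᴴ := fun r => by
      rw [Matrix.conjTranspose_mul]
      simp only [Matrix.mul_assoc]
    simp only [this, ← Matrix.sum_mul, ← Matrix.mul_sum]
    rw [Matrix.sub_mul, hP, Matrix.one_mul, sub_self, Matrix.zero_mul]
  have h1 := congrArg Matrix.trace h0
  rw [Matrix.trace_sum, Matrix.trace_zero] at h1
  have h2 := (Finset.sum_eq_zero_iff_of_nonneg fun r _ =>
    (Matrix.posSemidef_self_mul_conjTranspose _).trace_nonneg).mp h1 r (Finset.mem_univ r)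
  rw [Matrix.trace_mul_conjTranspose_self_eq_zero_iff, Matrix.sub_mul, Matrix.one_mul] at h2
  exact sub_eq_zero.mp h2

/-- If all steered states have the block form `⨁ⱼ ω j ⊗ X j`, so have all operators between
slices of `ψ`. -/
lemma exists_block_form_slice [DecidableEq A] {ψ : R × A × B → ℂ} {J : ℕ} {dL dR : Fin J → ℕ}
    {V : Matrix A (Blocks dL dR) ℂ} {ω : ∀ j, Op (Fin (dL j))}
    (h : ∀ ρ ∈ steeredStates ψ, ∃ X : ∀ j, Op (Fin (dR j)),
      Vᴴ * ρ * V = Matrix.blockDiagonal' fun j => ω j ⊗ₖ X j) (r r' : R) :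
    ∃ X : ∀ j, Op (Fin (dR j)), (Vᴴ * slice ψ r) * (Vᴴ * slice ψ r')ᴴ =
      Matrix.blockDiagonal' fun j => ω j ⊗ₖ X j := by
  classical
  let T : Submodule ℂ (Op R) :=
    { carrier := {Λ | ∃ X : ∀ j, Op (Fin (dR j)),
        Vᴴ * steer ψ Λ * V = Matrix.blockDiagonal' fun j => ω j ⊗ₖ X j}
      zero_mem' := ⟨0, by
        simp only [steer_eq_sum, Matrix.zero_apply, zero_smul, Finset.sum_const_zero,
          Matrix.mul_zero, Matrix.zero_mul, Pi.zero_apply, Matrix.kronecker_zero]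
        exact Matrix.blockDiagonal'_zero.symm⟩
      add_mem' := by
        rintro Λ Λ' ⟨X, hX⟩ ⟨X', hX'⟩
        refine ⟨X + X', ?_⟩
        have : steer ψ (Λ + Λ') = steer ψ Λ + steer ψ Λ' := by
          simp [steer_eq_sum, add_smul, Finset.sum_add_distrib]
        rw [this, Matrix.mul_add, Matrix.add_mul, hX, hX', ← Matrix.blockDiagonal'_add]
        congr 1
        funext j
        simp [Matrix.kronecker_add]
      smul_mem' := by
        rintro c Λ ⟨X, hX⟩
        refine ⟨c • X, ?_⟩
        have : steer ψ (c • Λ) = c • steer ψ Λ := by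
          simp [steer_eq_sum, Finset.smul_sum, smul_smul]
        rw [this, Matrix.mul_smul, Matrix.smul_mul, hX, ← Matrix.blockDiagonal'_smul]
        congr 1
        funext j
        simp [Matrix.kronecker_smul] }
  have hT : T = ⊤ := by
    rw [eq_top_iff, ← span_posSemidef R, Submodule.span_le]
    intro Λ hΛ
    have hpsd := steer_posSemidef ψ hΛ
    by_cases htr : (steer ψ Λ).trace = 0
    · rw [hpsd.trace_eq_zero_iff] at htr
      refine ⟨0, ?_⟩
      simp only [htr, Matrix.mul_zero, Matrix.zero_mul, Pi.zero_apply, Matrix.kronecker_zero]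
      exact Matrix.blockDiagonal'_zero.symm
    · obtain ⟨X, hX⟩ := h _ ⟨Λ, hΛ, htr, rfl⟩
      have h1 : (steer ψ Λ).trace • (steer ψ Λ).trace⁻¹ • steer ψ Λ = steer ψ Λ := by
        rw [smul_smul, mul_inv_cancel₀ htr, one_smul]
      refine ⟨(steer ψ Λ).trace • X, ?_⟩
      conv_lhs => rw [← h1]
      rw [Matrix.mul_smul, Matrix.smul_mul, hX, ← Matrix.blockDiagonal'_smul]
      congr 1
      funext j
      simp [Matrix.kronecker_smul]
  obtain ⟨X, hX⟩ : Matrix.single r' r 1 ∈ T := hT ▸ Submodule.mem_top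
  refine ⟨X, ?_⟩
  rw [← hX, steer_single]
  simp [Matrix.mul_assoc]

end Tripartite

lemma trace_mul_conjTranspose_eq_sum_norm {m n : Type} [Fintype m] [Fintype n] (X : Matrix m n ℂ) :
    (X * Xᴴ).trace = ((∑ i, ∑ k, ‖X i k‖ ^ 2 : ℝ) : ℂ) := by
  simp [Matrix.trace, Matrix.mul_apply, Complex.mul_conj, Complex.normSq_eq_norm_sq]

lemma traceSnd_proj {m n : Type} [Fintype n] (Y : Matrix m n ℂ) :
    traceSnd (proj fun x : m × n => Y x.1 x.2) = Y * Yᴴ := by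
  ext s s'
  simp [traceSnd, proj, Matrix.vecMulVec_apply, Matrix.mul_apply]

lemma sum_submatrix_mul {R l m : Type} [Fintype R] [Fintype l] (X : Matrix (R × l) m ℂ) :
    ∑ r, (X.submatrix (Prod.mk r) id)ᴴ * X.submatrix (Prod.mk r) id = Xᴴ * X := by
  ext i k
  simp [Matrix.sum_apply, Matrix.mul_apply, Fintype.sum_prod_type]

lemma mul_blockDiagonal'_mul_apply {A B : Type} {J : ℕ} {aL aR bL bR : Fin J → ℕ}
    (V : Matrix A (Blocks aL aR) ℂ) (L : Matrix (Blocks bL bR) B ℂ)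
    (Y : ∀ j, Matrix (Fin (aL j)) (Fin (bL j)) ℂ) (X : ∀ j, Matrix (Fin (aR j)) (Fin (bR j)) ℂ)
    (a : A) (b : B) :
    (V * (Matrix.blockDiagonal' (fun j => Y j ⊗ₖ X j) * L)) a b =
      ∑ j, ∑ s, ∑ t, ∑ u, ∑ v, V a ⟨j, s, t⟩ * L ⟨j, u, v⟩ b * Y j s u * X j t v := by
  simp only [Matrix.mul_apply, Fintype.sum_sigma, Fintype.sum_prod_type]
  refine Finset.sum_congr rfl fun j _ => Finset.sum_congr rfl fun s _ =>
    Finset.sum_congr rfl fun t _ => ?_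
  rw [Finset.sum_eq_single j]
  · simp only [Finset.mul_sum, Matrix.blockDiagonal'_apply_eq, Matrix.kroneckerMap_apply]
    exact Finset.sum_congr rfl fun u _ => Finset.sum_congr rfl fun v _ => by ring
  · intro k _ hk
    simp [Matrix.blockDiagonal'_apply_ne _ _ _ hk.symm]
  · simp

section Tripartite

variable {R A B : Type} [Fintype R] [Fintype A] [DecidableEq A] [Fintype B]

/-- Every tripartite pure state has a Koashi–Imoto decomposition. -/
theorem nonempty_koashiImoto {ψ : R × A × B → ℂ} (hψ : IsKet ψ) : Nonempty (KoashiImoto ψ) := by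
  classical
  have htr1 := steer_one_trace hψ
  obtain ⟨m, V₀, d, hd, hV₀, hρA⟩ :=
    exists_compact_spectral (steer_posSemidef ψ (Λ := 1) Matrix.PosSemidef.one)
  have hP : ∀ r, V₀ * V₀ᴴ * slice ψ r = slice ψ r := by
    refine sum_mul_slice_eq ?_
    rw [← steer_one, hρA, Matrix.mul_assoc V₀, Matrix.mul_assoc V₀, ← Matrix.mul_assoc V₀ᴴ, hV₀, Matrix.one_mul]
  obtain ⟨J, aL, aR, V, ω, hKI, hVV, hω, haR, hform⟩ :=
    exists_isKoashiImoto (S := steeredStates ψ) hV₀ hd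
      (by
        rw [← hρA]
        exact ⟨1, Matrix.PosSemidef.one, by simp [htr1], by simp [htr1]⟩)
      (fun ρ hρ => isDensity_of_mem_steeredStates hρ)
      (by
        rintro _ ⟨Λ, -, -, rfl⟩
        rw [Matrix.mul_smul, steer_eq_sum]
        simp only [Matrix.mul_sum, Matrix.mul_smul, ← Matrix.mul_assoc, hP])
  have htr : ∀ j, (ω j).trace = 1 := fun j => (hKI.density j).2
  have haL : ∀ j, 0 < aL j := fun j => Nat.pos_of_ne_zero fun h => by
    have : IsEmpty (Fin (aL j)) := by rw [h]; infer_instance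
    simpa [Matrix.trace] using htr j
  have hVs : ∀ r, V * (Vᴴ * slice ψ r) = slice ψ r := fun r => by
    rw [← Matrix.mul_assoc, hVV, hP]
  choose X hX using exists_block_form_slice hform
  -- the operator on `R ⊗ a_j^R` in each block
  let Θ : ∀ j, Op (R × Fin (aR j)) := fun j => Matrix.of fun x y => X x.1 y.1 j x.2 y.2
  have hΘ : ∀ j, (Θ j).PosSemidef := by
    intro j
    -- As `tr ω_j = 1`, tracing out the left factor of the Gram operator returns `Θ j`, which
    -- exhibits it as a sum of squares.
    have : Θ j = ∑ s, (Matrix.of fun (x : R × Fin (aR j)) b => (Vᴴ * slice ψ x.1) ⟨j, s, x.2⟩ b) *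
        (Matrix.of fun (x : R × Fin (aR j)) b => (Vᴴ * slice ψ x.1) ⟨j, s, x.2⟩ b)ᴴ := by
      ext ⟨r, t⟩ ⟨r', t'⟩
      rw [Matrix.sum_apply]
      have h1 : ∀ s, ((Matrix.of fun (x : R × Fin (aR j)) b => (Vᴴ * slice ψ x.1) ⟨j, s, x.2⟩ b) *
        (Matrix.of fun (x : R × Fin (aR j)) b => (Vᴴ * slice ψ x.1) ⟨j, s, x.2⟩ b)ᴴ) (r, t) (r', t')
          = ω j s s * X r r' j t t' := fun s => by
        have := congrFun (congrFun (hX r r') ⟨j, s, t⟩) ⟨j, s, t'⟩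
        rw [Matrix.blockDiagonal'_apply_eq, Matrix.kroneckerMap_apply] at this
        rw [← this]
        rfl
      simp only [h1, ← Finset.sum_mul]
      rw [show ∑ s, ω j s s = 1 from htr j, one_mul]
      rfl
    rw [this]
    exact Matrix.posSemidef_sum _ fun s _ => Matrix.posSemidef_self_mul_conjTranspose _
  choose bR Xf dX hdX hXX hXΘ using fun j => exists_mul_conjTranspose_eq (hΘ j)
  choose bL Y dY hdY hYY hYω using fun j => exists_mul_conjTranspose_eq (hω j).posSemidef
  -- Slices of a model purification, built from factorizations of `ω_j` and `Θ_j`, with the same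
  -- Gram operators as `ψ`. The dimensions `bL` and `bR` are the ranks, so the model has full column
  -- rank.
  let Z : R → Matrix (Blocks aL aR) (Blocks bL bR) ℂ := fun r =>
    Matrix.blockDiagonal' fun j => Y j ⊗ₖ (Xf j).submatrix (Prod.mk r) id
  let D : Blocks bL bR → ℝ := fun y => dY y.1 y.2.1 * dX y.1 y.2.2
  have hD : ∀ y, (D y : ℂ) ≠ 0 := fun y => by
    exact_mod_cast (mul_pos (hdY _ _) (hdX _ _)).ne'
  have hZ : ∑ r, (Z r)ᴴ * Z r = Matrix.diagonal fun y => (D y : ℂ) := by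
    simp only [Z, Matrix.blockDiagonal'_conjTranspose, ← Matrix.blockDiagonal'_mul,
      Matrix.conjTranspose_kronecker, ← Matrix.mul_kronecker_mul, blockDiagonal'_sum,
      kronecker_sum, sum_submatrix_mul, hYY, hXX, Matrix.diagonal_kronecker_diagonal]
    rw [Matrix.blockDiagonal'_diagonal]
    simp [D]
  have hZΨ : ∀ r r', Z r * (Z r')ᴴ = (Vᴴ * slice ψ r) * (Vᴴ * slice ψ r')ᴴ := by
    intro r r'
    rw [hX]
    simp only [Z, Matrix.blockDiagonal'_conjTranspose, ← Matrix.blockDiagonal'_mul,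
      Matrix.conjTranspose_kronecker, ← Matrix.mul_kronecker_mul, hYω]
    congr 1
    funext j
    congr 1
    ext t t'
    have := congrFun (congrFun (hXΘ j) (r, t)) (r', t')
    simpa [Matrix.mul_apply, Θ] using this
  obtain ⟨L, hL, hZL⟩ := exists_coisometry_of_gram_eq hD hZ hZΨ
  -- A block of zero weight would put a zero on the diagonal of the faithful compression of `ψ^A`.
  have hp0 : ∀ j, (Θ j).trace ≠ 0 := by
    intro j hj
    rw [(hΘ j).trace_eq_zero_iff] at hj
    have h1 : ((Vᴴ * V₀) * Matrix.diagonal (fun i => (d i : ℂ)) * (Vᴴ * V₀)ᴴ).PosDef := by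
      have hdpos : (Matrix.diagonal fun i => (d i : ℂ)).PosDef :=
        Matrix.PosDef.diagonal fun i => by exact_mod_cast hd i
      refine hdpos.mul_mul_conjTranspose_same fun x y hxy => ?_
      have h2 : (Vᴴ * V₀) * (Vᴴ * V₀)ᴴ = 1 := by
        rw [Matrix.conjTranspose_mul, Matrix.conjTranspose_conjTranspose, Matrix.mul_assoc,
          ← Matrix.mul_assoc V₀, ← hVV, Matrix.mul_assoc V, hKI.isometry, Matrix.mul_one,
          hKI.isometry]
      have h3 := congrArg (· ᵥ* (Vᴴ * V₀)ᴴ) hxy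
      simpa only [Matrix.vecMul_vecMul, h2, Matrix.vecMul_one] using h3
    have h2 : (Vᴴ * V₀) * Matrix.diagonal (fun i => (d i : ℂ)) * (Vᴴ * V₀)ᴴ =
        ∑ r, (Vᴴ * slice ψ r) * (Vᴴ * slice ψ r)ᴴ := by
      calc _ = Vᴴ * (V₀ * Matrix.diagonal (fun i => (d i : ℂ)) * V₀ᴴ) * V := by
            simp [Matrix.mul_assoc]
        _ = _ := by
            rw [← hρA, steer_one]
            simp [Matrix.mul_sum, Matrix.sum_mul, Matrix.mul_assoc]
    have h3 := h1.diag_pos (i := ⟨j, ⟨0, haL j⟩, ⟨0, haR j⟩⟩)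
    simp only [h2, hX, Matrix.sum_apply, Matrix.blockDiagonal'_apply_eq,
      Matrix.kroneckerMap_apply] at h3
    have h4 : ∀ r t, X r r j t t = 0 := fun r t => congrFun (congrFun hj (r, t)) (r, t)
    simp [h4] at h3
  have hpe : ∀ j, ∃ p : ℝ, 0 < p ∧ (p : ℂ) = (Θ j).trace := by
    intro j
    have h1 := lt_of_le_of_ne (hΘ j).trace_nonneg (hp0 j).symm
    have h2 := Complex.pos_iff.mp h1
    exact ⟨_, h2.1, Complex.ext rfl (by simpa using h2.2)⟩
  choose p hp hpΘ using hpe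
  have hpsum : ∑ j, p j = 1 := by
    have h1 : ∀ r, ∑ j, (X r r j).trace = (slice ψ r * (slice ψ r)ᴴ).trace := fun r => by
      have h2 := congrArg Matrix.trace (hX r r)
      rw [trace_blockDiagonal'_kronecker] at h2
      simp only [htr, one_mul] at h2
      rw [← h2, Matrix.conjTranspose_mul, Matrix.conjTranspose_conjTranspose,
        Matrix.trace_mul_comm, Matrix.mul_assoc, hVs, Matrix.trace_mul_comm]
    have h2 : (∑ j, (p j : ℂ)) = 1 := by
      rw [← htr1, steer_one, Matrix.trace_sum]
      simp only [← h1, hpΘ]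
      rw [Finset.sum_comm]
      refine Finset.sum_congr rfl fun j _ => ?_
      simp [Matrix.trace, Θ, Fintype.sum_prod_type]
    exact_mod_cast h2
  have hsq : ∀ j, ((√(p j) : ℝ) : ℂ) ≠ 0 := fun j => by
    exact_mod_cast (Real.sqrt_pos.mpr (hp j)).ne'
  -- The columns of a slice carry the unconjugated coordinates of `B`, so the embedding into `B` is
  -- the transpose, not the adjoint, of the coisometry `L`.
  refine ⟨{ J, aL, aR, bL, bR, V, W := Lᵀ, p,
            ω := fun j x => Y j x.1 x.2
            φ := fun j x => ((√(p j) : ℝ) : ℂ)⁻¹ * Xf j (x.1, x.2.1) x.2.2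
            isKoashiImoto := ?_, isometry_W := ?_, range_W := ?_, p_nonneg := fun j => (hp j).le
            p_sum := hpsum, isKet_ω := ?_, isKet_φ := ?_, decompose := ?_ }⟩
  · simpa only [traceSnd_proj, hYω] using hKI
  · rw [show Lᵀᴴ = Lᴴᵀ from rfl, ← Matrix.transpose_mul, hL, Matrix.transpose_one]
  · refine (supp_conj_diagonal ?_ hD ?_).symm
    · rw [show Lᵀᴴ = Lᴴᵀ from rfl, ← Matrix.transpose_mul, hL, Matrix.transpose_one]
    · rw [stateB_eq_sum, ← Matrix.diagonal_transpose, ← hZ, Matrix.transpose_sum, Matrix.mul_sum,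
        Matrix.sum_mul]
      refine Finset.sum_congr rfl fun r _ => ?_
      rw [show (slice ψ r)ᵀᴴ = (slice ψ r)ᴴᵀ from rfl, ← Matrix.transpose_mul, ← hVs r, ← hZL r,
        show Lᵀᴴ = Lᴴᵀ from rfl, ← Matrix.transpose_mul, ← Matrix.transpose_mul]
      congr 1
      calc _ = Lᴴ * (Z r)ᴴ * (Vᴴ * V) * Z r * L := by simp [Matrix.mul_assoc]
        _ = _ := by rw [hKI.isometry]; simp [Matrix.mul_assoc]
  · intro j
    have h1 := trace_mul_conjTranspose_eq_sum_norm (Y j)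
    rw [hYω, htr] at h1
    rw [IsKet, Fintype.sum_prod_type]
    exact_mod_cast h1.symm
  · intro j
    have h1 := trace_mul_conjTranspose_eq_sum_norm (Xf j)
    rw [hXΘ, ← hpΘ, Complex.ofReal_inj] at h1
    rw [IsKet]
    simp only [Fintype.sum_prod_type, norm_mul, mul_pow, ← Finset.mul_sum] at h1 ⊢
    rw [← h1, norm_inv, Complex.norm_real, Real.norm_of_nonneg (Real.sqrt_nonneg _), inv_pow,
      Real.sq_sqrt (hp j).le, inv_mul_cancel₀ (hp j).ne']
  · intro r a b
    have h1 : ψ (r, a, b) = (V * (Z r * L)) a b := by rw [hZL, hVs]; rfl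
    rw [h1, mul_blockDiagonal'_mul_apply]
    simp only [Finset.mul_sum]
    refine Finset.sum_congr rfl fun j _ => Finset.sum_congr rfl fun s _ =>
      Finset.sum_congr rfl fun t _ => Finset.sum_congr rfl fun u _ =>
      Finset.sum_congr rfl fun v _ => ?_
    simp only [Matrix.submatrix_apply, id, Matrix.transpose_apply]
    field_simp [hsq j]

end Tripartite

/-! ### Random injections and the coefficients of the measurement -/

/-- A probability distribution bounded by `1 / D` is the common marginal distribution of the values
of a random injection from a set of `D` elements. -/
lemma exists_random_injection {N : Type} [Fintype N] [DecidableEq N] {D : ℕ} {μ : N → ℝ}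
    (h0 : ∀ n, 0 ≤ μ n) (h1 : ∑ n, μ n = 1) (hD : ∀ n, D * μ n ≤ 1) :
    ∃ (w : Equiv.Perm N → ℝ) (g : Equiv.Perm N → Fin D → N), (∀ σ, 0 ≤ w σ) ∧ ∑ σ, w σ = 1 ∧
      (∀ σ, Function.Injective (g σ)) ∧ ∀ d n, ∑ σ, (if g σ d = n then w σ else 0) = μ n := by
  have hsum : ∑ n, (1 - D * μ n) = Fintype.card N - D := by
    rw [Finset.sum_sub_distrib, ← Finset.mul_sum, h1]
    simp
  have hcard : D ≤ Fintype.card N := by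
    have : 0 ≤ ∑ n, (1 - D * μ n) := Finset.sum_nonneg fun n _ => by linarith [hD n]
    rw [hsum] at this
    exact_mod_cast sub_nonneg.mp this
  obtain ⟨e⟩ : Nonempty (Fin D ↪ N) := Function.Embedding.nonempty_of_card_le (by simpa using hcard)
  have hcompl : ((Finset.univ.filter fun i => i ∉ Set.range e).card : ℝ) = Fintype.card N - D := by
    have h2 : (Finset.univ.filter fun i => i ∈ Set.range e).card = D := by
      have : (Finset.univ.filter fun i => i ∈ Set.range e) = Finset.univ.map e := by
        ext i
        simp
      rw [this]
      simp
    have h3 := Finset.card_filter_add_card_filter_not (s := (Finset.univ : Finset N))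
      (fun i => i ∈ Set.range e)
    rw [h2, Finset.card_univ] at h3
    rw [← h3]
    push_cast
    ring
  -- `D` rows equal to `μ`, while the other rows share the remaining column mass `1 - Dμ` equally;
  -- the bound on `μ` keeps it nonnegative. Birkhoff's theorem writes `T` as a mixture of
  -- permutations, whose restrictions to the `D` chosen rows are the injections.
  let T : Matrix N N ℝ := Matrix.of fun i n =>
    if i ∈ Set.range e then μ n else (1 - D * μ n) / (Fintype.card N - D)
  have hT : T ∈ doublyStochastic ℝ N := by
    rw [mem_doublyStochastic_iff_sum]
    refine ⟨fun i n => ?_, fun i => ?_, fun n => ?_⟩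
    · simp only [T, Matrix.of_apply]
      split_ifs
      · exact h0 n
      · refine div_nonneg (by linarith [hD n]) (sub_nonneg.mpr (by exact_mod_cast hcard))
    · simp only [T, Matrix.of_apply]
      by_cases hi : i ∈ Set.range e
      · simpa [hi] using h1
      · simp only [hi, if_false]
        rw [← Finset.sum_div, hsum]
        refine div_self fun h => ?_
        rw [← hcompl, Nat.cast_eq_zero, Finset.card_eq_zero, Finset.filter_eq_empty_iff] at h
        exact h (Finset.mem_univ i) hi
    · simp only [T, Matrix.of_apply]
      rw [Finset.sum_ite, Finset.sum_const, Finset.sum_const, nsmul_eq_mul, nsmul_eq_mul, hcompl]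
      have h2 : ((Finset.univ.filter fun i => i ∈ Set.range e).card : ℝ) = D := by
        have h3 := Finset.card_filter_add_card_filter_not (s := (Finset.univ : Finset N))
          (fun i => i ∈ Set.range e)
        rw [Finset.card_univ] at h3
        have h4 : ((Finset.univ.filter fun i => i ∈ Set.range e).card : ℝ) +
          ((Finset.univ.filter fun i => i ∉ Set.range e).card : ℝ) = Fintype.card N := by
          exact_mod_cast h3
        linarith
      rw [h2]
      -- If no rows remain, the nonnegative masses `1 - Dμ` sum to zero, so the chosen rows already
      -- fill every column.
      by_cases hN : (Fintype.card N : ℝ) - D = 0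
      · have h3 := (Finset.sum_eq_zero_iff_of_nonneg fun n _ => by linarith [hD n]).mp
          (hsum.trans hN) n (Finset.mem_univ n)
        rw [hN]
        linarith
      · rw [mul_div_cancel₀ _ hN]
        ring
  obtain ⟨w, hw0, hw1, hw⟩ := exists_eq_sum_perm_of_mem_doublyStochastic hT
  refine ⟨w, fun σ d => σ (e d), hw0, hw1, fun σ => σ.injective.comp e.injective, fun d n => ?_⟩
  have h2 := congrFun (congrFun hw (e d)) n
  simp only [T, Matrix.of_apply, Set.mem_range_self, if_true] at h2
  rw [← h2]
  simp [Matrix.sum_apply, Equiv.Perm.permMatrix, PEquiv.toMatrix_apply, eq_comm]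

/-- Flipping the sign at `i` alone reverses every term when `i ≠ k`. -/
lemma sum_signs_mul {ι : Type} [Fintype ι] [DecidableEq ι] (i k : ι) :
    ∑ ε : ι → ℤˣ, ((ε i : ℤ) : ℝ) * ((ε k : ℤ) : ℝ) =
      if i = k then (Fintype.card (ι → ℤˣ) : ℝ) else 0 := by
  split_ifs with h
  · subst h
    have : ∀ u : ℤˣ, ((u : ℤ) : ℝ) * ((u : ℤ) : ℝ) = 1 := fun u => by
      rw [← Int.cast_mul, Int.units_coe_mul_self, Int.cast_one]
    simp [this]
  · have h1 : ∑ ε : ι → ℤˣ, ((ε i : ℤ) : ℝ) * ((ε k : ℤ) : ℝ) =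
        ∑ ε : ι → ℤˣ, -(((ε i : ℤ) : ℝ) * ((ε k : ℤ) : ℝ)) := by
      refine Fintype.sum_equiv (Equiv.mulLeft (Pi.mulSingle i (-1))) _ _ fun ε => ?_
      have hk : (Pi.mulSingle i (-1) : ι → ℤˣ) k = 1 := Pi.mulSingle_eq_of_ne (Ne.symm h) _
      simp [hk]
    rw [Finset.sum_neg_distrib] at h1
    linarith

lemma sum_pi_prod_mul {J : Type} [Fintype J] [DecidableEq J] {Γ : J → Type} [∀ j, Fintype (Γ j)]
    {w : ∀ j, Γ j → ℝ} (hw : ∀ j, ∑ γ, w j γ = 1) (j : J) (F : Γ j → ℝ) :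
    ∑ γ : ∀ j, Γ j, (∏ j, w j (γ j)) * F (γ j) = ∑ γ, w j γ * F γ := by
  have h := Fintype.prod_sum fun i (x : Γ i) => w i x * (if h : i = j then F (h ▸ x) else 1)
  rw [← Finset.prod_erase_mul _ _ (Finset.mem_univ j), Finset.prod_eq_one, one_mul] at h
  · simp only [dite_true, Finset.prod_mul_distrib] at h
    rw [h]
    refine Finset.sum_congr rfl fun γ _ => ?_
    congr 1
    rw [Finset.prod_eq_single j]
    · simp
    · intro i _ hi
      simp [hi]
    · simp
  · intro i hi
    simp [(Finset.mem_erase.mp hi).1, hw]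

/-- Real coefficients of a rank-one measurement on `⨁ⱼ ℂ^(dL j) ⊗ ℂ^(dR j) ⊗ ℂ^K` that, on
`⨁ⱼ diag (l j) ⊗ ℂ^(dR j) ⊗ 1 / K`, does not reveal anything about `j` and about `ℂ^(dR j)`. -/
lemma exists_measurement_coefficients {J : ℕ} {dL dR : Fin J → ℕ} {K : ℕ} (hK : 0 < K)
    {l : ∀ j, Fin (dL j) → ℝ} (hl : ∀ j i, 0 < l j i) (hl1 : ∀ j, ∑ i, l j i = 1)
    (hlK : ∀ j i, l j i * dR j ≤ K) :
    ∃ (ι : Type) (_ : Fintype ι) (β : ι → Blocks dL dR → Fin K → ℝ) (q : ι → ℝ),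
      (∀ i, 0 ≤ q i) ∧ ∑ i, q i = 1 ∧
      (∀ x x' k k', ∑ i, β i x k * β i x' k' = if x = x' ∧ k = k' then 1 else 0) ∧
      ∀ i j t t', ∑ k, ∑ s, β i ⟨j, s, t⟩ k * β i ⟨j, s, t'⟩ k * l j s =
        if t = t' then K * q i else 0 := by
  have hK' : (0 : ℝ) < K := by exact_mod_cast hK
  let μ : ∀ j, Fin (dL j) × Fin K → ℝ := fun j n => l j n.1 / K
  have hμ : ∀ j n, 0 < μ j n := fun j n => div_pos (hl j n.1) hK'
  choose w g hw0 hw1 hg hwg using fun j => exists_random_injection (D := dR j) (μ := μ j)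
    (fun n => (hμ j n).le)
    (by simp [μ, Fintype.sum_prod_type, hl1 j, hK'.ne', mul_div_cancel₀])
    (fun n => by
      simp only [μ]
      rw [← mul_div_assoc, div_le_one hK', mul_comm]
      exact hlK j n.1)
  let Γ := ∀ j, Equiv.Perm (Fin (dL j) × Fin K)
  let Sg := (Σ j, Fin (dR j)) → ℤˣ
  let c : ℝ := Fintype.card Sg
  have hc : 0 < c := Nat.cast_pos.mpr (Fintype.card_pos_iff.mpr ⟨1⟩)
  let q : Γ × Sg → ℝ := fun i => (∏ j, w j (i.1 j)) / c
  have hq : ∀ i, 0 ≤ q i := fun i => div_nonneg (Finset.prod_nonneg fun j _ => hw0 j _) hc.le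
  have hprod : ∑ γ : Γ, ∏ j, w j (γ j) = 1 := by
    rw [← Fintype.prod_sum]
    simp [hw1]
  -- The vector `√q ∑ ε_{j,t} μ_j(g_j(t))^(-1/2) |g_j(t)⟩|t⟩`. Signs cancel cross terms between
  -- different `(j, t)`, and the marginal `μ_j` of the injection cancels `μ_j⁻¹` in the completeness
  -- sum. In the last property injectivity separates different `t`, and `μ_j⁻¹ l_j = K` makes all
  -- weights equal.
  let β : Γ × Sg → Blocks dL dR → Fin K → ℝ := fun i x k =>
    if g x.1 (i.1 x.1) x.2.2 = (x.2.1, k) then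
      √(q i) * ((i.2 ⟨x.1, x.2.2⟩ : ℤ) : ℝ) * (√(μ x.1 (x.2.1, k)))⁻¹ else 0
  refine ⟨Γ × Sg, inferInstance, β, q, hq, ?_, ?_, ?_⟩
  · simp only [q, Fintype.sum_prod_type, Finset.sum_const, Finset.card_univ, nsmul_eq_mul]
    rw [← Finset.mul_sum, ← Finset.sum_div, hprod]
    exact mul_one_div_cancel hc.ne'
  · rintro ⟨j, s, t⟩ ⟨j', s', t'⟩ k k'
    have h1 : ∀ γ : Γ, ∑ ε : Sg, β (γ, ε) ⟨j, s, t⟩ k * β (γ, ε) ⟨j', s', t'⟩ k' =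
        if (⟨j, t⟩ : Σ j, Fin (dR j)) = ⟨j', t'⟩ then
          (if g j (γ j) t = (s, k) ∧ g j' (γ j') t' = (s', k') then
            (∏ j, w j (γ j)) * ((√(μ j (s, k)))⁻¹ * (√(μ j' (s', k')))⁻¹) else 0) else 0 := by
      intro γ
      have h2 : ∀ ε : Sg, β (γ, ε) ⟨j, s, t⟩ k * β (γ, ε) ⟨j', s', t'⟩ k' =
          (if g j (γ j) t = (s, k) ∧ g j' (γ j') t' = (s', k') then
            (∏ j, w j (γ j)) * ((√(μ j (s, k)))⁻¹ * (√(μ j' (s', k')))⁻¹) / c else 0) *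
          (((ε ⟨j, t⟩ : ℤ) : ℝ) * ((ε ⟨j', t'⟩ : ℤ) : ℝ)) := by
        intro ε
        simp only [β]
        by_cases h3 : g j (γ j) t = (s, k) <;> by_cases h4 : g j' (γ j') t' = (s', k') <;>
          simp only [h3, h4, if_true, if_false, and_self, and_true, and_false, mul_zero,
            zero_mul]
        have h5 := Real.mul_self_sqrt (hq (γ, ε))
        calc _ = (√(q (γ, ε)) * √(q (γ, ε))) * ((√(μ j (s, k)))⁻¹ * (√(μ j' (s', k')))⁻¹) *
              (((ε ⟨j, t⟩ : ℤ) : ℝ) * ((ε ⟨j', t'⟩ : ℤ) : ℝ)) := by ring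
          _ = _ := by
            rw [h5]
            simp only [q]
            ring
      simp only [h2, ← Finset.mul_sum]
      rw [sum_signs_mul]
      split_ifs
      · change _ / c * c = _
        rw [div_mul_cancel₀ _ hc.ne']
      · simp
      · simp
      · simp
    rw [Fintype.sum_prod_type]
    simp only [h1]
    by_cases h3 : (⟨j, t⟩ : Σ j, Fin (dR j)) = ⟨j', t'⟩
    · obtain ⟨rfl, h4⟩ := Sigma.mk.inj h3
      obtain rfl := eq_of_heq h4
      simp only [if_true]
      by_cases h5 : (s, k) = (s', k')
      · obtain ⟨rfl, rfl⟩ := Prod.mk.inj h5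
        simp only [and_self, if_true]
        have h6 := sum_pi_prod_mul hw1 j fun σ =>
          if g j σ t = (s, k) then (√(μ j (s, k)))⁻¹ * (√(μ j (s, k)))⁻¹ else 0
        simp only [mul_ite, mul_zero] at h6
        rw [h6, ← mul_inv, Real.mul_self_sqrt (hμ _ _).le]
        have h7 := hwg j t (s, k)
        calc _ = (∑ σ, if g j σ t = (s, k) then w j σ else 0) * (μ j (s, k))⁻¹ := by
              rw [Finset.sum_mul]
              exact Finset.sum_congr rfl fun σ _ => by split_ifs <;> simp
          _ = 1 := by rw [h7, mul_inv_cancel₀ (hμ _ _).ne']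
      · have h6 : ∀ γ : Γ, ¬ (g j (γ j) t = (s, k) ∧ g j (γ j) t = (s', k')) := fun γ h =>
          h5 (h.1.symm.trans h.2)
        have h7 : ¬ ((⟨j, s, t⟩ : Blocks dL dR) = ⟨j, s', t⟩ ∧ k = k') := fun h => h5 (by
          have := h.1
          simp at this
          rw [this, h.2])
        rw [if_neg h7]
        simp [h6]
    · have h7 : ¬ ((⟨j, s, t⟩ : Blocks dL dR) = ⟨j', s', t'⟩ ∧ k = k') := by
        rintro ⟨h, -⟩
        obtain ⟨rfl, h⟩ := Sigma.mk.inj h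
        exact h3 (by rw [(Prod.mk.inj (eq_of_heq h)).2])
      rw [if_neg h7]
      simp [h3]
  · rintro ⟨γ, ε⟩ j t t'
    have h2 : ∀ k s, β (γ, ε) ⟨j, s, t⟩ k * β (γ, ε) ⟨j, s, t'⟩ k * l j s =
        if t = t' then (if g j (γ j) t = (s, k) then K * q (γ, ε) else 0) else 0 := by
      intro k s
      simp only [β]
      by_cases h3 : g j (γ j) t = (s, k)
      · by_cases h4 : t = t'
        · subst h4
          have h5 := Real.mul_self_sqrt (hq (γ, ε))
          have h6 : (√(μ j (s, k)))⁻¹ * (√(μ j (s, k)))⁻¹ * l j s = K := by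
            rw [← mul_inv, Real.mul_self_sqrt (hμ _ _).le]
            simp only [μ]
            field_simp [(hl j s).ne']
          have h7 : ((ε ⟨j, t⟩ : ℤ) : ℝ) * ((ε ⟨j, t⟩ : ℤ) : ℝ) = 1 := by
            rw [← Int.cast_mul, Int.units_coe_mul_self, Int.cast_one]
          simp only [h3, if_true]
          calc _ = (√(q (γ, ε)) * √(q (γ, ε))) * (((ε ⟨j, t⟩ : ℤ) : ℝ) * ((ε ⟨j, t⟩ : ℤ) : ℝ)) *
                ((√(μ j (s, k)))⁻¹ * (√(μ j (s, k)))⁻¹ * l j s) := by ring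
            _ = _ := by rw [h5, h6, h7]; ring
        · have h5 : g j (γ j) t' ≠ (s, k) := fun h => h4 (hg j (γ j) (h3.trans h.symm))
          simp [h4, h5]
      · simp [h3]
    simp only [h2]
    split_ifs with h
    · rw [Finset.sum_comm, ← Fintype.sum_prod_type' (fun s k =>
        if g j (γ j) t = (s, k) then (K : ℝ) * q (γ, ε) else 0)]
      simp
    · simp

/-! ### Branches of a channel on pure states and local recovery -/

section Channels

lemma idTensor_sum {r m n ι : Type} [Fintype ι] (E : ι → Op n →ₗ[ℂ] Op m) (ρ : Op (r × n)) :
    idTensor r (∑ i, E i) ρ = ∑ i, idTensor r (E i) ρ := by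
  ext x y
  simp [idTensor, LinearMap.sum_apply, Matrix.sum_apply]

lemma idTensor_conjMap_proj {r m n : Type} [Fintype n] (G : Matrix m n ℂ) (χ : r × n → ℂ) :
    idTensor r (conjMap G) (proj χ) = proj fun x => ∑ y, G x.2 y * χ (x.1, y) := by
  ext x y
  simp only [idTensor, conjMap, proj, Matrix.of_apply, LinearMap.coe_mk, AddHom.coe_mk,
    Matrix.mul_apply, Matrix.vecMulVec_apply, Pi.star_apply, star_sum, star_mul',
    Matrix.conjTranspose_apply]
  rw [Finset.sum_mul_sum, Finset.sum_comm]
  refine Finset.sum_congr rfl fun i _ => ?_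
  rw [Finset.sum_mul]
  exact Finset.sum_congr rfl fun k _ => by ring

lemma conjMap_comp {l m n : Type} [Fintype m] [Fintype n] (G : Matrix l m ℂ) (G' : Matrix m n ℂ) :
    conjMap G ∘ₗ conjMap G' = conjMap (G * G') := by
  ext1 ρ
  simp [conjMap, Matrix.mul_assoc]

lemma proj_smul {n : Type} (c : ℂ) (ψ : n → ℂ) :
    proj (fun x => c * ψ x) = ((‖c‖ ^ 2 : ℝ) : ℂ) • proj ψ := by
  ext x y
  simp only [proj, Matrix.vecMulVec_apply, Pi.star_apply, Matrix.smul_apply, smul_eq_mul, star_mul']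
  rw [← Complex.normSq_eq_norm_sq, ← Complex.mul_conj, RCLike.star_def]
  ring

end Channels

/-- Two operators with proportional Gram operators are related by a partial isometry on the
right. -/
lemma exists_partialIsometry {R b c : Type} [Fintype R] [DecidableEq R] [Fintype b] [DecidableEq b]
    [Fintype c] {X : Matrix R b ℂ} {Y : Matrix R c ℂ} {q : ℝ} (hq : 0 ≤ q)
    (h : X * Xᴴ = (q : ℂ) • (Y * Yᴴ)) :
    ∃ (T : Matrix b c ℂ) (Q : Op b), Qᴴ = Q ∧ Q * Q = Q ∧ T * Tᴴ = Q ∧ X * Q = X ∧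
      X * T = ((√q : ℝ) : ℂ) • Y := by
  rcases hq.eq_or_lt with rfl | hq
  · have hX : X = 0 := by
      rw [← Matrix.self_mul_conjTranspose_eq_zero, h]
      simp
    exact ⟨0, 0, by simp, by simp, by simp, by simp [hX], by simp⟩
  -- `Y` and `X / √q` have the same Gram operator `ZZ†`, so each is `Z` followed by a coisometry,
  -- `L₁` and `L₂`; then `L₂ᴴ * L₁` carries one to the other.
  · obtain ⟨m, Z, d, hd, hZd, hZ⟩ :=
      exists_mul_conjTranspose_eq (Matrix.posSemidef_self_mul_conjTranspose Y)
    have hs : ((√q : ℝ) : ℂ) ≠ 0 := by exact_mod_cast (Real.sqrt_pos.mpr hq).ne'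
    have hs2 : ((√q : ℝ) : ℂ)⁻¹ * (((√q : ℝ) : ℂ)⁻¹ * q) = 1 := by
      have : (q : ℂ) = ((√q : ℝ) : ℂ) * ((√q : ℝ) : ℂ) := by
        rw [← Complex.ofReal_mul, Real.mul_self_sqrt hq.le]
      rw [this]
      field_simp
    have hd' : ∀ i, (d i : ℂ) ≠ 0 := fun i => by exact_mod_cast (hd i).ne'
    obtain ⟨L₁, hL₁, hY⟩ := exists_coisometry_of_gram_eq (ι := Unit) (Z := fun _ => Z)
      (Ψ := fun _ => Y) hd' (by simpa using hZd) fun _ _ => hZ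
    obtain ⟨L₂, hL₂, hX⟩ := exists_coisometry_of_gram_eq (ι := Unit) (Z := fun _ => Z)
      (Ψ := fun _ => ((√q : ℝ) : ℂ)⁻¹ • X) hd' (by simpa using hZd) fun _ _ => by
        have hstar : star (((√q : ℝ) : ℂ)⁻¹) = ((√q : ℝ) : ℂ)⁻¹ := by
          rw [← Complex.ofReal_inv, RCLike.star_def, Complex.conj_ofReal]
        rw [Matrix.conjTranspose_smul, hstar, Matrix.smul_mul, Matrix.mul_smul, h, smul_smul,
          smul_smul, mul_assoc, hs2, one_smul, hZ]
    have hX' : X = ((√q : ℝ) : ℂ) • (Z * L₂) := by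
      rw [hX (), smul_smul, mul_inv_cancel₀ hs, one_smul]
    refine ⟨L₂ᴴ * L₁, L₂ᴴ * L₂, by simp, ?_, ?_, ?_, ?_⟩
    · rw [Matrix.mul_assoc, ← Matrix.mul_assoc L₂, hL₂, Matrix.one_mul]
    · rw [Matrix.conjTranspose_mul, Matrix.mul_assoc, ← Matrix.mul_assoc L₁, hL₁, Matrix.one_mul,
        Matrix.conjTranspose_conjTranspose]
    · rw [hX', Matrix.smul_mul, Matrix.mul_assoc, ← Matrix.mul_assoc L₂, hL₂, Matrix.one_mul]
    · rw [hX', Matrix.smul_mul, Matrix.mul_assoc, ← Matrix.mul_assoc L₂, hL₂, Matrix.one_mul,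
        hY ()]

/-- If the reduced states of two (unnormalized) kets agree up to the factor `q`, then a local
channel on the purifying system maps one to `q` times the other. -/
lemma exists_measurement_of_gram_eq {R b c : Type} [Fintype R] [DecidableEq R] [Fintype b]
    [DecidableEq b] [Fintype c] [DecidableEq c] [Nonempty c] {X : Matrix R b ℂ} {Y : Matrix R c ℂ}
    {q : ℝ} (hq : 0 ≤ q) (h : X * Xᴴ = (q : ℂ) • (Y * Yᴴ)) :
    ∃ (l : ℕ) (N : Fin l → Matrix c b ℂ) (s : Fin l → ℂ), IsMeasurement N ∧
      (∀ j, X * (N j)ᵀ = s j • Y) ∧ ∑ j, ‖s j‖ ^ 2 = q := by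
  obtain ⟨T, Q, hQ, hQQ, hT, hXQ, hXT⟩ := exists_partialIsometry hq h
  obtain ⟨x₀⟩ := ‹Nonempty c›
  -- The transposed partial isometry, completed to a channel by sending the complement of `Q` to a
  -- fixed basis ket. The added outcomes have amplitude zero because `X * (1 - Q) = 0`.
  let N : Option b → Matrix c b ℂ := fun i => i.elim Tᵀ fun i =>
    Matrix.of fun x y => if x = x₀ then (1 - Q)ᵀ i y else 0
  let s : Option b → ℂ := fun i => i.elim ((√q : ℝ) : ℂ) fun _ => 0
  let e := (Fintype.equivFin (Option b)).symm
  refine ⟨_, fun j => N (e j), fun j => s (e j), ?_, fun j => ?_, ?_⟩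
  · rw [IsMeasurement, e.sum_comp fun i => (N i)ᴴ * N i, Fintype.sum_option]
    have h1 : (N none)ᴴ * N none = Qᵀ := by
      simp only [N, Option.elim_none]
      rw [show Tᵀᴴ = Tᴴᵀ from rfl, ← Matrix.transpose_mul, hT]
    have h2 : ∑ i, (N (some i))ᴴ * N (some i) = ((1 - Q)ᵀ)ᴴ * (1 - Q)ᵀ := by
      ext y y'
      simp only [N, Option.elim_some, Matrix.sum_apply, Matrix.mul_apply,
        Matrix.conjTranspose_apply, Matrix.of_apply]
      refine Finset.sum_congr rfl fun i _ => ?_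
      rw [Finset.sum_eq_single x₀ (fun x _ hx => by simp [hx]) (by simp)]
      simp
    have h3 : ((1 - Q)ᵀ)ᴴ * (1 - Q)ᵀ = (1 - Q)ᵀ := by
      have hPP : (1 - Q) * (1 - Q) = 1 - Q := by
        rw [Matrix.mul_sub, Matrix.mul_one, Matrix.sub_mul, Matrix.one_mul, hQQ, sub_self, sub_zero]
      rw [show ((1 - Q)ᵀ)ᴴ = ((1 - Q)ᴴ)ᵀ from rfl, ← Matrix.transpose_mul,
        Matrix.conjTranspose_sub, Matrix.conjTranspose_one, hQ, hPP]
    rw [h1, h2, h3, Matrix.transpose_sub, Matrix.transpose_one, add_sub_cancel]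
  · have key : ∀ i : Option b, X * (N i)ᵀ = s i • Y := by
      rintro (_ | i)
      · simpa [N, s] using hXT
      have h1 : X * (1 - Q) = 0 := by rw [Matrix.mul_sub, hXQ, Matrix.mul_one, sub_self]
      simp only [N, s, Option.elim_some, zero_smul]
      ext r x
      simp only [Matrix.mul_apply, Matrix.transpose_apply, Matrix.of_apply, Matrix.zero_apply]
      split_ifs
      · exact congrFun (congrFun h1 r) i
      · simp
    exact key (e j)
  · rw [e.sum_comp fun i => ‖s i‖ ^ 2, Fintype.sum_option]
    simp [s, Complex.norm_real, Real.norm_of_nonneg (Real.sqrt_nonneg q), Real.sq_sqrt hq]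

/-! ### Merging from a measurement that reveals nothing about `R` -/

section Merging

variable {R A B : Type} [Fintype R] [Fintype A] [DecidableEq A] [Fintype B] [DecidableEq B]

/-- The (unnormalized) state of `R` and Bob after Alice's outcome `f` on `ψ ⊗ Φ_K`. -/
def postMeasurement (ψ : R × A × B → ℂ) {K : ℕ} (f : A × Fin K → ℂ) : Matrix R (B × Fin K) ℂ :=
  Matrix.of fun r x => ∑ a, f (a, x.2) * ψ (r, a, x.1) * ((√(K : ℝ))⁻¹ : ℝ)

/-- Alice's rank-one measurement achieves exact merging if it reveals nothing about `R`. -/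
lemma exactMerging_of_measurement {ψ : R × A × B → ℂ} (hψ : IsKet ψ) {K : ℕ} {ι : Type}
    [Fintype ι] {f : ι → A × Fin K → ℂ} {q : ι → ℝ}
    (hf : ∀ x y, ∑ i, star (f i x) * f i y = if x = y then 1 else 0) (hq : ∀ i, 0 ≤ q i)
    (hq1 : ∑ i, q i = 1)
    (hgram : ∀ i r r', (postMeasurement ψ (f i) * (postMeasurement ψ (f i))ᴴ) r r' =
      q i * (slice ψ r * (slice ψ r')ᴴ).trace) :
    ExactMerging ψ K 1 := by
  classical
  have hne : Nonempty (A × B × Fin 1) := by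
    by_contra hcon
    rw [not_nonempty_iff] at hcon
    have : IsEmpty (R × A × B) := ⟨fun x => hcon.elim (x.2.1, x.2.2, 0)⟩
    simp [IsKet] at hψ
  let Y : Matrix R (A × B × Fin 1) ℂ := Matrix.of fun r x => ψ (r, x.1, x.2.1)
  have hY : ∀ i, postMeasurement ψ (f i) * (postMeasurement ψ (f i))ᴴ =
      (q i : ℂ) • (Y * Yᴴ) := fun i => by
    ext r r'
    rw [hgram, Matrix.smul_apply, smul_eq_mul]
    congr 1
    simp [Y, Matrix.trace, Matrix.mul_apply, slice, Fintype.sum_prod_type]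
  choose l N s hN hs hsq using fun i => exists_measurement_of_gram_eq (hq i) (hY i)
  let e := (Fintype.equivFin ι).symm
  let M : Fin (Fintype.card ι) → Matrix (Fin 1) (A × Fin K) ℂ := fun i => Matrix.of fun _ x => f (e i) x
  have hM : IsMeasurement M := by
    ext x y
    simp only [M, Matrix.sum_apply, Matrix.mul_apply, Matrix.conjTranspose_apply, Matrix.of_apply,
      Finset.univ_unique, Finset.sum_singleton]
    rw [e.sum_comp fun i => star (f i x) * f i y, hf, Matrix.one_apply]
  have h1 : IsMeasurement fun _ : Fin 1 => (1 : Op (Fin 1)) := by simp [IsMeasurement]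
  -- One-way protocol: Alice's rank-one outcome leaves her with the trivial system `Fin 1`, and Bob
  -- answers with the recovery channel for that outcome. Each branch is a multiple of the target,
  -- and the weights add up to one.
  refine ⟨_, .alice M hM _ fun i => .local (fun _ => 1) (N (e i)) h1 (hN (e i)), ?_⟩
  have hterm : ∀ i j, idTensor R (conjMap ((1 : Op (Fin 1)) ⊗ₖ N (e i) j) ∘ₗ
      conjMap (M i ⊗ₖ (1 : Op (B × Fin K)))) (proj (mergeInput ψ K)) =
        ((‖s (e i) j‖ ^ 2 : ℝ) : ℂ) • proj (mergeOutput ψ 1) := by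
    intro i j
    rw [conjMap_comp, ← Matrix.mul_kronecker_mul, Matrix.one_mul, Matrix.mul_one,
      idTensor_conjMap_proj, ← proj_smul]
    congr 1
    funext ⟨r, k₀, a', b', l'⟩
    have h2 : mergeOutput ψ 1 (r, k₀, a', b', l') = ψ (r, a', b') := by
      simp [mergeOutput, maxEnt, Subsingleton.elim k₀ l']
    rw [h2]
    have h3 := congrFun (congrFun (hs (e i) j) r) (a', b', l')
    simp only [Matrix.smul_apply, smul_eq_mul, Y, Matrix.of_apply] at h3
    rw [← h3, Matrix.mul_apply]
    simp only [Fintype.sum_prod_type, postMeasurement, Matrix.of_apply, Matrix.transpose_apply,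
      Matrix.kroneckerMap_apply, mergeInput, M]
    have h4 : ∀ a, ∑ k : Fin K, ∑ b, ∑ l'', f (e i) (a, k) * N (e i) j (a', b', l') (b, l'') *
        (ψ (r, a, b) * maxEnt K (k, l'')) = ∑ b, ∑ l'', f (e i) (a, l'') * ψ (r, a, b) *
          ((√(K : ℝ))⁻¹ : ℝ) * N (e i) j (a', b', l') (b, l'') := by
      intro a
      rw [Finset.sum_comm]
      refine Finset.sum_congr rfl fun b _ => ?_
      rw [Finset.sum_comm]
      refine Finset.sum_congr rfl fun l'' _ => ?_
      rw [Finset.sum_eq_single l'' (fun k _ hk => by simp [maxEnt, hk]) (by simp)]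
      simp only [maxEnt, if_true]
      ring
    simp only [h4, Finset.sum_mul]
    rw [Finset.sum_comm]
    refine Finset.sum_congr rfl fun b _ => ?_
    rw [Finset.sum_comm]
  have hcomp : ∀ i, (∑ x : Fin 1, ∑ j, conjMap ((1 : Op (Fin 1)) ⊗ₖ N (e i) j)) ∘ₗ
      conjMap (M i ⊗ₖ (1 : Op (B × Fin K))) = ∑ j, conjMap ((1 : Op (Fin 1)) ⊗ₖ N (e i) j) ∘ₗ
        conjMap (M i ⊗ₖ (1 : Op (B × Fin K))) := fun i => by
    ext1 ρ
    simp [LinearMap.sum_apply]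
  simp only [hcomp, idTensor_sum, hterm]
  simp only [← Finset.sum_smul, ← Complex.ofReal_sum, hsq]
  rw [e.sum_comp q, hq1, Complex.ofReal_one, one_smul]

end Merging

/-! ### Spectrum of the left factors -/

section LeftSpectrum

lemma eigenvalues_le_maxEigenvalue {n : Type} [Fintype n] [DecidableEq n] {ρ : Op n}
    (hρ : ρ.IsHermitian) (i : n) : hρ.eigenvalues i ≤ maxEigenvalue ρ := by
  refine le_csSup ?_ (hρ.eigenvalues_mem_spectrum_real i)
  rw [hρ.spectrum_real_eq_range_eigenvalues]
  exact (Set.finite_range _).bddAbove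

/-- The left factors of a Koashi–Imoto decomposition are nondegenerate. -/
lemma IsKoashiImoto.eq_zero_of_mul_eq_zero {A : Type} [Fintype A] {S : Set (Op A)} {J : ℕ}
    {dL dR : Fin J → ℕ} {V : Matrix A (Blocks dL dR) ℂ} {ω : ∀ j, Op (Fin (dL j))}
    (h : IsKoashiImoto S V ω) (hdR : ∀ j, 0 < dR j) {N : ∀ j, Op (Fin (dL j))}
    (hN : ∀ j, ω j * N j = 0) (j : Fin J) : N j = 0 := by
  let D : Op (Blocks dL dR) := Matrix.blockDiagonal' fun j => N j ⊗ₖ (1 : Op (Fin (dR j)))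
  have hS : ∀ ρ ∈ S, (V * D)ᴴ * ρ = 0 := by
    intro ρ hρ
    obtain ⟨p, φ, -, -, -, rfl⟩ := h.decompose ρ hρ
    have h1 : ∀ j, (N j)ᴴ * ω j = 0 := fun j => by
      rw [← (h.density j).1.isHermitian.eq, ← Matrix.conjTranspose_mul, hN,
        Matrix.conjTranspose_zero]
    have h2 : Dᴴ * Matrix.blockDiagonal' (fun j => (p j : ℂ) • (ω j ⊗ₖ φ j)) = 0 := by
      simp only [D, Matrix.blockDiagonal'_conjTranspose]
      rw [← Matrix.blockDiagonal'_mul, ← Matrix.blockDiagonal'_zero]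
      congr 1
      funext j
      rw [Matrix.conjTranspose_kronecker, Matrix.mul_smul, ← Matrix.mul_kronecker_mul, h1,
        Matrix.zero_kronecker, smul_zero]
      rfl
    rw [Matrix.conjTranspose_mul, Matrix.mul_assoc V, Matrix.mul_assoc Dᴴ, ← Matrix.mul_assoc Vᴴ,
      h.isometry, Matrix.one_mul, ← Matrix.mul_assoc, h2, Matrix.zero_mul]
  -- Annihilating every state of `S` means annihilating the joint support, which is the whole range
  -- of `V`; this forces `D = 0`.
  have hle : LinearMap.range V.mulVecLin ≤ LinearMap.ker ((V * D)ᴴ).mulVecLin := by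
    rw [h.range_eq]
    refine iSup₂_le fun ρ hρ => ?_
    rintro _ ⟨x, rfl⟩
    rw [LinearMap.mem_ker, ← LinearMap.comp_apply, ← Matrix.mulVecLin_mul, hS ρ hρ,
      Matrix.mulVecLin_zero, LinearMap.zero_apply]
  have h0 : (V * D)ᴴ * V = 0 := by
    refine Matrix.mulVec_injective (funext fun x => ?_)
    have := hle ⟨x, rfl⟩
    rw [LinearMap.mem_ker, ← LinearMap.comp_apply, ← Matrix.mulVecLin_mul] at this
    rw [Matrix.mulVecLin_apply] at this
    rw [this, Matrix.zero_mulVec]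
  rw [Matrix.conjTranspose_mul, Matrix.mul_assoc, h.isometry, Matrix.mul_one,
    Matrix.conjTranspose_eq_zero] at h0
  ext s s'
  have := congrFun (congrFun h0 ⟨j, s, ⟨0, hdR j⟩⟩) ⟨j, s', ⟨0, hdR j⟩⟩
  simpa [D, Matrix.blockDiagonal'_apply_eq] using this

/-- Strict positivity holds since an `N` built from null eigenvectors would satisfy `ω j * N j = 0`.
It is needed because the measurement coefficients divide by square roots of the eigenvalues. -/
lemma IsKoashiImoto.exists_diagonalization {A : Type} [Fintype A] {S : Set (Op A)} {J : ℕ}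
    {dL dR : Fin J → ℕ} {V : Matrix A (Blocks dL dR) ℂ} {ω : ∀ j, Op (Fin (dL j))}
    (h : IsKoashiImoto S V ω) (hdR : ∀ j, 0 < dR j) :
    ∃ (E : ∀ j, Op (Fin (dL j))) (l : ∀ j, Fin (dL j) → ℝ), (∀ j, (E j)ᴴ * E j = 1) ∧
      (∀ j, ω j = E j * Matrix.diagonal (fun i => (l j i : ℂ)) * (E j)ᴴ) ∧ (∀ j i, 0 < l j i) ∧
        (∀ j, ∑ i, l j i = 1) ∧ ∀ j i, l j i ≤ maxEigenvalue (ω j) := by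
  have hH : ∀ j, (ω j).IsHermitian := fun j => (h.density j).1.isHermitian
  choose E hE hE' hω using fun j => exists_unitary_diagonalization (hH j)
  refine ⟨E, fun j => (hH j).eigenvalues, hE, hω, fun j i => ?_, fun j => ?_, fun j =>
    eigenvalues_le_maxEigenvalue (hH j)⟩
  · refine ((h.density j).1.eigenvalues_nonneg i).lt_of_ne' fun hi => ?_
    let N : ∀ j, Op (Fin (dL j)) := fun j =>
      E j * Matrix.diagonal fun i => if (hH j).eigenvalues i = 0 then 1 else 0
    have hN : ∀ j, ω j * N j = 0 := fun j => by
      conv_lhs => rw [hω j]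
      simp only [N]
      rw [Matrix.mul_assoc, ← Matrix.mul_assoc (E j)ᴴ, hE, Matrix.one_mul, Matrix.mul_assoc,
        Matrix.diagonal_mul_diagonal]
      have h1 : (fun i => ((hH j).eigenvalues i : ℂ) *
          if (hH j).eigenvalues i = 0 then 1 else 0) = 0 := by
        funext i
        split_ifs with h0 <;> simp [h0]
      rw [h1]
      exact (congrArg _ Matrix.diagonal_zero).trans (Matrix.mul_zero _)
    have h0 := congrArg ((E j)ᴴ * ·) (h.eq_zero_of_mul_eq_zero hdR hN j)
    simp only [N, Matrix.mul_zero] at h0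
    rw [← Matrix.mul_assoc, hE, Matrix.one_mul] at h0
    have := congrFun (congrFun h0 i) i
    simp [hi] at this
  · have := (hH j).trace_eq_sum_eigenvalues
    rw [(h.density j).2] at this
    apply Complex.ofReal_injective
    rw [Complex.ofReal_sum, Complex.ofReal_one]
    exact this.symm

end LeftSpectrum

/-! ### Alice's measurement for block-diagonal states -/

section Protocol

/-- Contracting with `Φ_K` hands Alice's index `k` to Bob at amplitude `K^(-1/2)`, so Bob's
unnormalized state is `F * slice ψ r` and the Gram entry is a trace. -/
lemma postMeasurement_gram {R A B : Type} [Fintype A] [Fintype B] (ψ : R × A × B → ℂ) {K : ℕ} (F : Matrix (Fin K) A ℂ) (r r' : R) :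
    (postMeasurement ψ (fun x => F x.2 x.1) * (postMeasurement ψ fun x => F x.2 x.1)ᴴ) r r' =
      (K : ℂ)⁻¹ * (F * (slice ψ r * (slice ψ r')ᴴ) * Fᴴ).trace := by
  have h1 : ∀ r b l, postMeasurement ψ (fun x => F x.2 x.1) r (b, l) =
      (F * slice ψ r) l b * ((√(K : ℝ))⁻¹ : ℝ) := fun r b l => by
    simp [postMeasurement, Matrix.mul_apply, slice, Finset.sum_mul]
  have h2 : ((√(K : ℝ))⁻¹ : ℝ) * star (((√(K : ℝ))⁻¹ : ℝ) : ℂ) = (K : ℂ)⁻¹ := by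
    rw [RCLike.star_def, Complex.conj_ofReal, ← Complex.ofReal_mul, ← mul_inv,
      Real.mul_self_sqrt (Nat.cast_nonneg K)]
    simp
  have h3 : F * (slice ψ r * (slice ψ r')ᴴ) * Fᴴ = F * slice ψ r * (F * slice ψ r')ᴴ := by
    simp only [Matrix.conjTranspose_mul, Matrix.mul_assoc]
  rw [h3, Matrix.trace, Matrix.mul_apply, Fintype.sum_prod_type, Finset.sum_comm, Finset.mul_sum]
  refine Finset.sum_congr rfl fun l _ => ?_
  rw [Matrix.diag_apply, Matrix.mul_apply, Finset.mul_sum]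
  refine Finset.sum_congr rfl fun b _ => ?_
  rw [Matrix.conjTranspose_apply, Matrix.conjTranspose_apply, h1, h1, star_mul', ← h2]
  ring

/-- Block diagonality removes interference between different `j`. The constant `c` is the same in
every block and for every `t`, so the outcome is blind to `j` and to the right factor. -/
lemma trace_mul_blockDiagonal'_diagonal_mul {J K : ℕ} {dL dR : Fin J → ℕ}
    {β : Blocks dL dR → Fin K → ℝ} {l : ∀ j, Fin (dL j) → ℝ} {c : ℝ}
    (hβ : ∀ j t t', ∑ k, ∑ s, β ⟨j, s, t⟩ k * β ⟨j, s, t'⟩ k * l j s = if t = t' then c else 0)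
    (X : ∀ j, Op (Fin (dR j))) :
    ((Matrix.of fun k x => (β x k : ℂ)) *
      Matrix.blockDiagonal' (fun j => Matrix.diagonal (fun s => (l j s : ℂ)) ⊗ₖ X j) *
        (Matrix.of fun k x => (β x k : ℂ))ᴴ).trace = c * ∑ j, (X j).trace := by
  have hβ' : ∀ j t t', ∑ k, ∑ s, (β ⟨j, s, t⟩ k : ℂ) * β ⟨j, s, t'⟩ k * l j s =
      if t = t' then (c : ℂ) else 0 := fun j t t' => by
    have := congrArg (fun x : ℝ => (x : ℂ)) (hβ j t t')
    push_cast at this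
    rw [this]
    split_ifs <;> rfl
  rw [Matrix.mul_assoc, Matrix.trace]
  simp only [Matrix.diag_apply, mul_blockDiagonal'_mul_apply]
  rw [Finset.sum_comm, Finset.mul_sum]
  refine Finset.sum_congr rfl fun j _ => ?_
  have h1 : ∀ k, ∑ s, ∑ t, ∑ u, ∑ v, (Matrix.of fun k x => (β x k : ℂ)) k ⟨j, s, t⟩ *
      (Matrix.of fun k x => (β x k : ℂ))ᴴ ⟨j, u, v⟩ k *
        Matrix.diagonal (fun s => (l j s : ℂ)) s u * X j t v =
      ∑ t, ∑ v, (∑ s, (β ⟨j, s, t⟩ k : ℂ) * β ⟨j, s, v⟩ k * l j s) * X j t v := fun k => by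
    rw [Finset.sum_comm]
    refine Finset.sum_congr rfl fun t _ => ?_
    simp only [Finset.sum_mul]
    conv_rhs => rw [Finset.sum_comm]
    refine Finset.sum_congr rfl fun s _ => ?_
    rw [Finset.sum_eq_single s (fun u _ hu => by simp [Matrix.diagonal_apply_ne' _ hu]) (by simp)]
    simp
  simp only [h1]
  rw [Finset.sum_comm]
  have h2 : ∀ t, ∑ k, ∑ v, (∑ s, (β ⟨j, s, t⟩ k : ℂ) * β ⟨j, s, v⟩ k * l j s) * X j t v =
      c * X j t t := fun t => by
    rw [Finset.sum_comm]
    simp only [← Finset.sum_mul, hβ']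
    simp
  simp only [h2, Matrix.trace, Matrix.diag_apply, Finset.mul_sum]

lemma sum_star_mul_of_orthonormal {A X ι : Type} [Fintype X] [DecidableEq X] [Fintype ι] {K : ℕ}
    {β : ι → X → Fin K → ℝ}
    (hβ : ∀ x x' k k', ∑ i, β i x k * β i x' k' = if x = x' ∧ k = k' then 1 else 0)
    (V : Matrix A X ℂ) (a a' : A) (k k' : Fin K) :
    ∑ i, star (((Matrix.of fun k x => (β i x k : ℂ)) * Vᴴ) k a) *
      ((Matrix.of fun k x => (β i x k : ℂ)) * Vᴴ) k' a' = if k = k' then (V * Vᴴ) a a' else 0 := by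
  have h2 : ∀ x x', ∑ i, (β i x k : ℂ) * β i x' k' = if x = x' ∧ k = k' then 1 else 0 :=
    fun x x' => by
      have := congrArg (fun x : ℝ => (x : ℂ)) (hβ x x' k k')
      push_cast at this
      rw [this]
      split_ifs <;> rfl
  have h3 : ∀ i, star (((Matrix.of fun k x => (β i x k : ℂ)) * Vᴴ) k a) *
      ((Matrix.of fun k x => (β i x k : ℂ)) * Vᴴ) k' a' =
        ∑ x, ∑ x', V a x * star (V a' x') * ((β i x k : ℂ) * β i x' k') := fun i => by
    have h5 : ∀ c : ℝ, star (c : ℂ) = c := Complex.conj_ofReal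
    simp only [Matrix.mul_apply, Matrix.of_apply, Matrix.conjTranspose_apply, star_sum,
      star_mul', star_star, h5, Finset.sum_mul_sum]
    exact Finset.sum_congr rfl fun x _ => Finset.sum_congr rfl fun x' _ => by ring
  simp only [h3]
  rw [Finset.sum_comm]
  have h4 : ∀ x, ∑ i, ∑ x', V a x * star (V a' x') * ((β i x k : ℂ) * β i x' k') =
      if k = k' then V a x * star (V a' x) else 0 := fun x => by
    rw [Finset.sum_comm]
    simp only [← Finset.mul_sum, h2]
    rw [Finset.sum_eq_single x (fun x' _ hx => by simp [hx.symm]) (by simp)]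
    simp
  simp only [h4]
  split_ifs
  · simp [Matrix.mul_apply]
  · simp

variable {R A B : Type} [Fintype R] [Fintype A] [DecidableEq A] [Fintype B] [DecidableEq B]

/-- Exact merging of a state whose slices are block diagonal with diagonal left factors. -/
lemma exactMerging_of_block_form {ψ : R × A × B → ℂ} (hψ : IsKet ψ) {J K : ℕ} (hK : 0 < K)
    {dL dR : Fin J → ℕ} {V : Matrix A (Blocks dL dR) ℂ} (hV : Vᴴ * V = 1)
    (hVψ : ∀ r, V * Vᴴ * slice ψ r = slice ψ r) {l : ∀ j, Fin (dL j) → ℝ}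
    (hl : ∀ j i, 0 < l j i) (hl1 : ∀ j, ∑ i, l j i = 1) (hlK : ∀ j i, l j i * dR j ≤ K)
    {X : R → R → ∀ j, Op (Fin (dR j))}
    (hX : ∀ r r', Vᴴ * (slice ψ r * (slice ψ r')ᴴ) * V =
      Matrix.blockDiagonal' fun j => Matrix.diagonal (fun s => (l j s : ℂ)) ⊗ₖ X r r' j) :
    ExactMerging ψ K 1 := by
  obtain ⟨ι, _, β, q, hq, hq1, hβ, hβq⟩ := exists_measurement_coefficients hK hl hl1 hlK
  have hK' : (K : ℂ) ≠ 0 := by exact_mod_cast hK.ne'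
  let b : ι → Matrix (Fin K) (Blocks dL dR) ℂ := fun i => Matrix.of fun k x => (β i x k : ℂ)
  let P : Op A := 1 - V * Vᴴ
  have hP : Pᴴ = P := by simp [P]
  have hPV : P * V = 0 := by
    rw [Matrix.sub_mul, Matrix.mul_assoc, hV, Matrix.one_mul, Matrix.mul_one, sub_self]
  have hPP : P * P = P := by
    conv_lhs => rw [show P * P = P * (1 - V * Vᴴ) from rfl]
    rw [Matrix.mul_sub, ← Matrix.mul_assoc, hPV, Matrix.zero_mul, Matrix.mul_one, sub_zero]
  have hPψ : ∀ r, P * slice ψ r = 0 := fun r => by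
    rw [Matrix.sub_mul, hVψ, Matrix.one_mul, sub_self]
  -- The constructed vectors resolve the identity only on the range of `V`. The rows of `P = 1 - V *
  -- Vᴴ`, for each index in `Fin K`, complete the measurement; these outcomes get `q = 0` since `P`
  -- annihilates `ψ`.
  let F : ι ⊕ A × Fin K → Matrix (Fin K) A ℂ := Sum.elim (fun i => b i * Vᴴ)
    fun x => Matrix.of fun k a => if k = x.2 then P x.1 a else 0
  refine exactMerging_of_measurement hψ (f := fun i x => F i x.2 x.1)
    (q := Sum.elim q fun _ => 0) ?_ ?_ ?_ ?_
  · rintro ⟨a, k⟩ ⟨a', k'⟩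
    have h5 : ∑ x : A × Fin K, star (if k = x.2 then P x.1 a else 0) *
        (if k' = x.2 then P x.1 a' else 0) = if k = k' then P a a' else 0 := by
      rw [Fintype.sum_prod_type]
      have h6 : ∀ a₀, ∑ k₀, star (if k = k₀ then P a₀ a else 0) *
          (if k' = k₀ then P a₀ a' else 0) = if k = k' then Pᴴ a a₀ * P a₀ a' else 0 := fun a₀ => by
        rw [Finset.sum_eq_single k (fun k₀ _ hk => by simp [hk.symm]) (by simp)]
        simp [eq_comm]
      simp only [h6]
      split_ifs
      · rw [← Matrix.mul_apply, hP, hPP]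
      · simp
    rw [Fintype.sum_sum_type]
    simp only [F, Sum.elim_inl, Sum.elim_inr]
    rw [sum_star_mul_of_orthonormal hβ]
    simp only [Matrix.of_apply, h5]
    by_cases hk : k = k'
    · simp [hk, P, Matrix.one_apply]
    · simp [hk]
  · rintro (i | x)
    · exact hq i
    · exact le_rfl
  · simpa using hq1
  · rintro (i | x) r r'
    · rw [postMeasurement_gram]
      have h1 : b i * Vᴴ * (slice ψ r * (slice ψ r')ᴴ) * (b i * Vᴴ)ᴴ =
          b i * Matrix.blockDiagonal' (fun j => Matrix.diagonal (fun s => (l j s : ℂ)) ⊗ₖ X r r' j) *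
            (b i)ᴴ := by
        rw [← hX]
        simp only [Matrix.conjTranspose_mul, Matrix.conjTranspose_conjTranspose, Matrix.mul_assoc]
      have h2 : (slice ψ r * (slice ψ r')ᴴ).trace = ∑ j, (X r r' j).trace := by
        have h3 : (slice ψ r * (slice ψ r')ᴴ).trace =
            (Vᴴ * (slice ψ r * (slice ψ r')ᴴ) * V).trace := by
          conv_lhs => rw [← hVψ r]
          rw [Matrix.mul_assoc V, Matrix.mul_assoc V, Matrix.trace_mul_comm V, Matrix.mul_assoc Vᴴ]
        rw [h3, hX, trace_blockDiagonal'_kronecker]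
        refine Finset.sum_congr rfl fun j _ => ?_
        rw [Matrix.trace_diagonal, ← Complex.ofReal_sum, hl1, Complex.ofReal_one, one_mul]
      simp only [F, Sum.elim_inl]
      rw [h1, h2, trace_mul_blockDiagonal'_diagonal_mul (c := K * q i) (hβq i), Complex.ofReal_mul,
        Complex.ofReal_natCast, mul_assoc, inv_mul_cancel_left₀ hK']
    · rw [postMeasurement_gram]
      have h1 : F (Sum.inr x) = (Matrix.single x.2 x.1 1 : Matrix (Fin K) A ℂ) * P := by
        ext k a
        rw [Matrix.mul_apply, Finset.sum_eq_single x.1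
          (fun a' _ ha => by simp [Matrix.single, ha.symm]) (by simp)]
        simp [F, Matrix.single, eq_comm]
      rw [h1, Matrix.mul_assoc (Matrix.single _ _ _), ← Matrix.mul_assoc P, hPψ]
      simp

end Protocol

/-! ### Merging from a Koashi–Imoto decomposition -/

section KoashiImoto

lemma KoashiImoto.aR_pos {R A B : Type} [Fintype R] [Fintype A] [DecidableEq A] [Fintype B]
    {ψ : R × A × B → ℂ} (D : KoashiImoto ψ) (j : Fin D.J) : 0 < D.aR j := by
  refine Nat.pos_of_ne_zero fun h => ?_
  have : IsEmpty (R × Fin (D.aR j) × Fin (D.bR j)) := ⟨fun x => by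
    have := x.2.1.2
    omega⟩
  have h1 := D.isKet_φ j
  simp [IsKet] at h1

lemma KoashiImoto.lambda₀_pos {R A B : Type} [Fintype R] [Fintype A] [DecidableEq A] [Fintype B]
    {ψ : R × A × B → ℂ} (D : KoashiImoto ψ) (j : Fin D.J) : 0 < D.lambda₀ j := by
  obtain ⟨-, l, -, -, hl, hl1, hlmax⟩ := D.isKoashiImoto.exists_diagonalization D.aR_pos
  obtain ⟨i⟩ : Nonempty (Fin (D.aL j)) := by
    by_contra h
    rw [not_nonempty_iff] at h
    simpa using hl1 j
  exact (hl j i).trans_le (hlmax j i)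

variable {R A B : Type} [Fintype R] [Fintype A] [DecidableEq A] [Fintype B] [DecidableEq B]

/-- The eigenbases of the `ω_j` are absorbed into `V` through the block unitary `G`, and the
isometry `W` drops out of the Gram operators. What remains is `⨁ diag(l_j) ⊗ Φ_r Φ_{r'}†`, the input
of `exactMerging_of_block_form`. -/
lemma KoashiImoto.exactMerging {ψ : R × A × B → ℂ} (hψ : IsKet ψ) (D : KoashiImoto ψ) {K : ℕ}
    (hK : 0 < K) (hDK : ∀ j, D.lambda₀ j * D.aR j ≤ K) : ExactMerging ψ K 1 := by
  obtain ⟨E, l, hE, hω, hl, hl1, hlmax⟩ := D.isKoashiImoto.exists_diagonalization D.aR_pos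
  have hE' : ∀ j, E j * (E j)ᴴ = 1 := fun j => mul_eq_one_comm.mp (hE j)
  let Y : ∀ j, Matrix (Fin (D.aL j)) (Fin (D.bL j)) ℂ := fun j => Matrix.of fun s u => D.ω j (s, u)
  let Φ : R → ∀ j, Matrix (Fin (D.aR j)) (Fin (D.bR j)) ℂ := fun r j =>
    Matrix.of fun t v => (√(D.p j) : ℂ) * D.φ j (r, t, v)
  have hY : ∀ j, Y j * (Y j)ᴴ = E j * Matrix.diagonal (fun i => (l j i : ℂ)) * (E j)ᴴ :=
    fun j => by rw [← hω j, ← traceSnd_proj]; rfl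
  have hslice : ∀ r, slice ψ r =
      D.V * (Matrix.blockDiagonal' (fun j => Y j ⊗ₖ Φ r j) * D.Wᵀ) := fun r => by
    ext a b
    rw [mul_blockDiagonal'_mul_apply]
    simp only [slice, Matrix.of_apply, D.decompose, Finset.mul_sum]
    refine Finset.sum_congr rfl fun j _ => Finset.sum_congr rfl fun s _ =>
      Finset.sum_congr rfl fun t _ => Finset.sum_congr rfl fun u _ =>
        Finset.sum_congr rfl fun v _ => ?_
    simp only [Y, Φ, Matrix.of_apply, Matrix.transpose_apply]
    ring
  have hW : D.Wᵀ * (D.Wᵀ)ᴴ = 1 := by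
    rw [show (D.Wᵀ)ᴴ = (D.Wᴴ)ᵀ from rfl, ← Matrix.transpose_mul, D.isometry_W,
      Matrix.transpose_one]
  have hV := D.isKoashiImoto.isometry
  let G : Op (Blocks D.aL D.aR) :=
    Matrix.blockDiagonal' fun j => E j ⊗ₖ (1 : Op (Fin (D.aR j)))
  have hG : Gᴴ * G = 1 := by
    simp only [G, Matrix.blockDiagonal'_conjTranspose]
    rw [← Matrix.blockDiagonal'_mul]
    simp only [Matrix.conjTranspose_kronecker, ← Matrix.mul_kronecker_mul, hE,
      Matrix.conjTranspose_one, Matrix.mul_one, Matrix.one_kronecker_one]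
    exact Matrix.blockDiagonal'_one
  have hG' : G * Gᴴ = 1 := mul_eq_one_comm.mp hG
  have hGD : ∀ r, Gᴴ * Matrix.blockDiagonal' (fun j => Y j ⊗ₖ Φ r j) =
      Matrix.blockDiagonal' fun j => ((E j)ᴴ * Y j) ⊗ₖ Φ r j := fun r => by
    simp only [G, Matrix.blockDiagonal'_conjTranspose]
    rw [← Matrix.blockDiagonal'_mul]
    simp only [Matrix.conjTranspose_kronecker, ← Matrix.mul_kronecker_mul,
      Matrix.conjTranspose_one, Matrix.one_mul]
  have hVG : ∀ r, (D.V * G)ᴴ * slice ψ r =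
      Matrix.blockDiagonal' (fun j => ((E j)ᴴ * Y j) ⊗ₖ Φ r j) * D.Wᵀ := fun r => by
    rw [hslice, Matrix.conjTranspose_mul, Matrix.mul_assoc, ← Matrix.mul_assoc D.Vᴴ, hV,
      Matrix.one_mul, ← Matrix.mul_assoc, hGD]
  refine exactMerging_of_block_form hψ hK (V := D.V * G) ?_ ?_ hl hl1 ?_
    (X := fun r r' j => Φ r j * (Φ r' j)ᴴ) ?_
  · rw [Matrix.conjTranspose_mul, Matrix.mul_assoc, ← Matrix.mul_assoc D.Vᴴ, hV, Matrix.one_mul, hG]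
  · intro r
    rw [Matrix.conjTranspose_mul, Matrix.mul_assoc D.V, ← Matrix.mul_assoc G, hG', Matrix.one_mul,
      hslice, Matrix.mul_assoc D.V, ← Matrix.mul_assoc D.Vᴴ, hV, Matrix.one_mul]
  · exact fun j i => (mul_le_mul_of_nonneg_right (hlmax j i) (Nat.cast_nonneg _)).trans (hDK j)
  · intro r r'
    have h1 : (D.V * G)ᴴ * (slice ψ r * (slice ψ r')ᴴ) * (D.V * G) =
        ((D.V * G)ᴴ * slice ψ r) * ((D.V * G)ᴴ * slice ψ r')ᴴ := by
      rw [Matrix.conjTranspose_mul ((D.V * G)ᴴ), Matrix.conjTranspose_conjTranspose]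
      simp only [Matrix.mul_assoc]
    rw [h1, hVG, hVG, Matrix.conjTranspose_mul, Matrix.mul_assoc, ← Matrix.mul_assoc D.Wᵀ, hW,
      Matrix.one_mul, Matrix.blockDiagonal'_conjTranspose, ← Matrix.blockDiagonal'_mul]
    congr 1
    funext j
    rw [Matrix.conjTranspose_kronecker, ← Matrix.mul_kronecker_mul, Matrix.conjTranspose_mul,
      Matrix.conjTranspose_conjTranspose, Matrix.mul_assoc, ← Matrix.mul_assoc (Y j), hY]
    congr 1
    rw [Matrix.mul_assoc, hE, Matrix.mul_one, ← Matrix.mul_assoc, hE, Matrix.one_mul]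

end KoashiImoto

end QMerge

end

theorem mainTheorem3 {R A B : Type} [Fintype R] [Fintype A] [DecidableEq A] [Fintype B]
    [DecidableEq B] (ψ : R × A × B → ℂ) (hψ : QMerge.IsKet ψ) :
    Nonempty (QMerge.KoashiImoto ψ) ∧
      ∀ D : QMerge.KoashiImoto ψ, ∃ K : ℕ, 1 ≤ K ∧
        Real.logb 2 K ≤ ⨆ j : Fin D.J, Real.logb 2 (⌈D.lambda₀ j * D.aR j⌉ : ℤ) ∧
        QMerge.ExactMerging ψ K 1 := by
  refine ⟨QMerge.nonempty_koashiImoto hψ, fun D => ?_⟩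
  have : Nonempty (Fin D.J) := by
    by_contra h
    rw [not_nonempty_iff] at h
    simpa using D.p_sum
  -- `K` is the largest ceiling. There is at least one block because `p` sums to one, and the
  -- ceiling is positive because `λ₀` and the dimension are.
  obtain ⟨j₀, hj₀⟩ := Finite.exists_max fun j : Fin D.J => ⌈D.lambda₀ j * D.aR j⌉
  have hpos : 0 < ⌈D.lambda₀ j₀ * D.aR j₀⌉ :=
    Int.ceil_pos.mpr (mul_pos (D.lambda₀_pos j₀) (by exact_mod_cast D.aR_pos j₀))
  have hcast : ((⌈D.lambda₀ j₀ * D.aR j₀⌉.toNat : ℕ) : ℝ) =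
      ((⌈D.lambda₀ j₀ * D.aR j₀⌉ : ℤ) : ℝ) := by
    exact_mod_cast congrArg (fun z : ℤ => (z : ℝ)) (Int.toNat_of_nonneg hpos.le)
  refine ⟨⌈D.lambda₀ j₀ * D.aR j₀⌉.toNat, by omega, ?_, D.exactMerging hψ (by omega) fun j => ?_⟩
  · rw [hcast]
    exact le_ciSup (f := fun j : Fin D.J => Real.logb 2 (⌈D.lambda₀ j * D.aR j⌉ : ℤ))
      (Set.finite_range _).bddAbove j₀
  · rw [hcast]
    exact (Int.le_ceil _).trans (by exact_mod_cast hj₀ j)
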